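/- Let $H$ be a complex Hilbert space, $H=H_+\oplus H_-$ an orthogonal decomposition into infinite dimensional closed subspaces, and $E_+,E_-$ the orthogonal projections onto $H_+,H_-$. Let $1\le p<\infty$, let $\mathcal B_p$ denote the Schatten class of operators $T$ with $\mathrm{Tr}(|T|^p)<\infty$, with norm $\|T\|_p=\mathrm{Tr}(|T|^p)^{1/p}$, let $\mathcal A^p=\{A\in\mathcal B(H): [A,E_+]\in\mathcal B_p(H)\}$ with the norm $\|A\|_{\infty,p}=\|A_{11}\|+\|A_{22}\|+\|A_{12}\|_p+\|A_{21}\|_p$ (matrix entries with respect to $H=H_+\oplus H_-$), let $\mathcal P^p$ be the set of orthogonal projections in $\mathcal A^p$, and let $\mathcal U_{\mathcal A^p}$ be the group of unitary operators of $H$ that are invertible in $\mathcal A^p$. Let $\pi:\mathcal B(H)\to\mathcal B(H)/\mathcal K(H)$ be the quotient map onto the Calkin algebra, and put $$\mathbb D_3=\{P\in\mathcal P^p:\pi(P)=\pi(E_+)\},\qquad \mathbb D_4=\{P\in\mathcal P^p:\pi(P)=\pi(E_-)\},$$ i.e. in $2\times 2$ matrices with respect to $\pi(E_+)+\pi(E_-)=1$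 the image $\pi(P)$ is $\mathrm{diag}(1,0)$, respectively $\mathrm{diag}(0,1)$. For a sign $\sigma\in\{+,-\}$, with $-\sigma$ the opposite sign, let $\mathcal O(E_\sigma)=\{UE_\sigma U^*:U\in\mathcal U_{\mathcal A^p}\}$, and let the $p$-restricted Grassmannian $Gr^p_{res}(E_\sigma)$ be the set of orthogonal projections $P$ in $H$ such that $E_\sigma|_{R(P)}:R(P)\to H_\sigma$ is $p$-Fredholm (invertible modulo $\mathcal B_p$) and $E_{-\sigma}|_{R(P)}\in\mathcal B_p(R(P),H)$. For $k\in\mathbb Z$ let $Gr^p_{res,k}(E_\sigma)$ be the set of those $P\in Gr^p_{res}(E_\sigma)$ for which $E_\sigma|_{R(P)}:R(P)\to H_\sigma$ has index $\dim\ker-\dim\mathrm{coker}=k$. Then: 1. $\mathbb D_3=\mathcal O(E_+)=\{P \text{ orthogonal projection}: P-E_+\in\mathcal B_p(H)\}=Gr^p_{res}(E_+)$. For every $P\in\mathbb D_3$ the operator $E_+|_{R(P)}:R(P)\to H_+$ has finite dimensional kernel and cokernel, and $k\mapsto Gr^p_{res,k}(E_+)$ is a bijection from $\mathbb Z$ onto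 the set of connected components of $\mathbb D_3$, in the topology of $\|\cdot\|_{\infty,p}$. 2. $\mathbb D_4=\mathcal O(E_-)=\{P \text{ orthogonal projection}: P-E_-\in\mathcal B_p(H)\}=Gr^p_{res}(E_-)$. For every $P\in\mathbb D_4$ the operator $E_-|_{R(P)}:R(P)\to H_-$ has finite dimensional kernel and cokernel, and $k\mapsto Gr^p_{res,k}(E_-)$ is a bijection from $\mathbb Z$ onto the set of connected components of $\mathbb D_4$, in the topology of $\|\cdot\|_{\infty,p}$. -/

import Mathlib

open scoped InnerProductSpace ENNReal

noncomputable section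

namespace RestrictedGrassmannian

section Schatten

variable {E F : Type*} [NormedAddCommGroup E] [InnerProductSpace ℂ E] [CompleteSpace E]
  [NormedAddCommGroup F] [InnerProductSpace ℂ F] [CompleteSpace F]

/-- The trace `∑ᵢ ⟪eᵢ, A eᵢ⟫ ∈ [0, ∞]` of a positive operator, computed in a Hilbert basis
(the value does not depend on the basis). -/
def posTrace (A : E →L[ℂ] E) : ℝ≥0∞ :=
  ∑' i : (exists_hilbertBasis ℂ E).choose,
    ENNReal.ofReal (RCLike.re ⟪(i : E), A (i : E)⟫_ℂ)

/-- `|T| = (T* T)^{1/2}`. -/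
def absOp (T : E →L[ℂ] F) : E →L[ℂ] E :=
  CFC.sqrt (T.adjoint ∘L T)

/-- `Tr (|T|^p) ∈ [0, ∞]`. -/
def traceAbsPow (p : ℝ) (T : E →L[ℂ] F) : ℝ≥0∞ :=
  posTrace (CFC.rpow (absOp T) p)

/-- `T` belongs to the Schatten class `𝓑_p(E, F)`, that is, `Tr (|T|^p) < ∞`. -/
def IsSchatten (p : ℝ) (T : E →L[ℂ] F) : Prop :=
  traceAbsPow p T < ∞

/-- The Schatten norm `‖T‖_p = Tr (|T|^p)^{1/p}` (meaningful for `T ∈ 𝓑_p(E, F)`). -/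
def schattenNorm (p : ℝ) (T : E →L[ℂ] F) : ℝ :=
  (traceAbsPow p T).toReal ^ (1 / p)

/-- `T` is `p`-Fredholm: invertible modulo the Schatten class `𝓑_p`. -/
def IsPFredholm (p : ℝ) (T : E →L[ℂ] F) : Prop :=
  ∃ S : F →L[ℂ] E,
    IsSchatten p (S ∘L T - ContinuousLinearMap.id ℂ E) ∧
    IsSchatten p (T ∘L S - ContinuousLinearMap.id ℂ F)

/-- The Fredholm index `dim ker T - dim coker T` (meaningful when both are finite). -/
def fredholmIndex (T : E →L[ℂ] F) : ℤ :=
  (Module.finrank ℂ T.ker : ℤ) - (Module.finrank ℂ (F ⧸ T.range) : ℤ)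

end Schatten

variable {H : Type*} [NormedAddCommGroup H] [InnerProductSpace ℂ H] [CompleteSpace H]

section Calkin

variable (H) in
/-- The two-sided ideal `𝓚(H)` of compact operators. -/
def compactIdeal : TwoSidedIdeal (H →L[ℂ] H) :=
  TwoSidedIdeal.mk' {T : H →L[ℂ] H | IsCompactOperator T}
    isCompactOperator_zero
    (fun {_ _} hx hy => hx.add hy)
    (fun {_} hx => hx.neg)
    (fun {x _} hy => hy.clm_comp x)
    (fun {_ y} hx => hx.comp_clm y)

/-- The quotient map `π : 𝓑(H) → 𝓑(H)/𝓚(H)` onto the Calkin algebra. -/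
def calkin : (H →L[ℂ] H) →+* (compactIdeal H).ringCon.Quotient :=
  (compactIdeal H).ringCon.mk'

end Calkin

/-- The range of an orthogonal projection is complete. -/
theorem completeSpace_range {P : H →L[ℂ] H} (hP : IsStarProjection P) :
    CompleteSpace P.range :=
  (ContinuousLinearMap.IsIdempotentElem.isClosed_range hP.isIdempotentElem).completeSpace_coe

/-! `K` is the closed subspace `H₊`, and `Kᗮ` is `H₋`; the orthogonal projections `E₊`, `E₋` are
`K.starProjection`, `Kᗮ.starProjection`. -/

section Classes

variable (p : ℝ) (K : Submodule ℂ H) [CompleteSpace K]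

/-- `A ∈ 𝓐^p`, that is, `[A, E₊] ∈ 𝓑_p(H)`. -/
def MemA (A : H →L[ℂ] H) : Prop :=
  IsSchatten p (A * K.starProjection - K.starProjection * A)

/-- `𝓟^p`: the orthogonal projections in `𝓐^p`. -/
def projections : Set (H →L[ℂ] H) :=
  {P | IsStarProjection P ∧ MemA p K P}

/-- `𝓤_{𝓐^p}`: the unitary operators that are invertible in `𝓐^p`. -/
def unitaries : Set (H →L[ℂ] H) :=
  {U | U ∈ unitary (H →L[ℂ] H) ∧ MemA p K U ∧ MemA p K (star U)}

/-- The orbit `{U E U* : U ∈ 𝓤_{𝓐^p}}`. -/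
def orbit (E : H →L[ℂ] H) : Set (H →L[ℂ] H) :=
  {P | ∃ U ∈ unitaries p K, P = U * E * star U}

/-- `𝔻₃`: the `P ∈ 𝓟^p` with `π(P) = diag(1, 0)`. The matrices are taken with respect to
`π(E₊) + π(E₋) = 1`, so that `diag(1, 0)` is `π(E₊)`. -/
def D3 : Set (H →L[ℂ] H) :=
  {P | P ∈ projections p K ∧ calkin P = calkin K.starProjection}

/-- `𝔻₄`: the `P ∈ 𝓟^p` with `π(P) = diag(0, 1) = π(E₋)`. -/
def D4 : Set (H →L[ℂ] H) :=
  {P | P ∈ projections p K ∧ calkin P = calkin Kᗮ.starProjection}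

/-- The compression of `A` to an operator `M → L`: an entry of the operator matrix of `A`. -/
def entry (L M : Submodule ℂ H) [CompleteSpace L] (A : H →L[ℂ] H) : M →L[ℂ] L :=
  L.orthogonalProjectionOnto ∘L A ∘L M.subtypeL

/-- `‖A‖_{∞,p} = ‖A₁₁‖ + ‖A₂₂‖ + ‖A₁₂‖_p + ‖A₂₁‖_p`. -/
def normInfP (A : H →L[ℂ] H) : ℝ :=
  ‖entry K K A‖ + ‖entry Kᗮ Kᗮ A‖ + schattenNorm p (entry K Kᗮ A) +
    schattenNorm p (entry Kᗮ K A)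

/-- The algebra `𝓐^p`. -/
def AlgA : Type _ := {A : H →L[ℂ] H // MemA p K A}

/-- The topology of the norm `‖·‖_{∞,p}` on `𝓐^p`. -/
instance : TopologicalSpace (AlgA p K) where
  IsOpen U := ∀ A ∈ U, ∃ r > 0, ∀ B : AlgA p K, normInfP p K (B.1 - A.1) < r → B ∈ U
  isOpen_univ := fun _ _ => ⟨1, one_pos, fun _ _ => trivial⟩
  isOpen_inter := by
    intro U V hU hV A hA
    obtain ⟨r, hr, h⟩ := hU A hA.1
    obtain ⟨s, hs, h'⟩ := hV A hA.2
    exact ⟨min r s, lt_min hr hs, fun B hB =>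
      ⟨h B (hB.trans_le (min_le_left _ _)), h' B (hB.trans_le (min_le_right _ _))⟩⟩
  isOpen_sUnion := by
    intro S hS A hA
    obtain ⟨U, hU, hAU⟩ := hA
    obtain ⟨r, hr, h⟩ := hS U hU A hAU
    exact ⟨r, hr, fun B hB => ⟨U, hU, h B hB⟩⟩

/-- A set of operators, regarded as a subset of `𝓐^p`. -/
def inAlgA (S : Set (H →L[ℂ] H)) : Set (AlgA p K) := {A | A.1 ∈ S}

end Classes

section Grassmannian

variable (L : Submodule ℂ H) [CompleteSpace L]

/-- The restriction `E_L|_{R(P)} : R(P) → L` of the orthogonal projection `E_L` onto `L`. -/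
def restrictedProj (P : H →L[ℂ] H) : P.range →L[ℂ] L :=
  L.orthogonalProjectionOnto ∘L P.range.subtypeL

/-- The `p`-restricted Grassmannian of `L`: the orthogonal projections `P` such that
`E_L|_{R(P)} : R(P) → L` is `p`-Fredholm and `(1 - E_L)|_{R(P)} : R(P) → H` is in `𝓑_p`. -/
def Gr (p : ℝ) : Set (H →L[ℂ] H) :=
  {P | ∃ hP : IsStarProjection P,
    haveI := completeSpace_range hP
    IsPFredholm p (restrictedProj L P) ∧
    IsSchatten p (Lᗮ.starProjection ∘L P.range.subtypeL)}

/-- The elements of the `p`-restricted Grassmannian of `L` with index `k`. -/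
def GrIndex (p : ℝ) (k : ℤ) : Set (H →L[ℂ] H) :=
  {P | P ∈ Gr L p ∧ fredholmIndex (restrictedProj L P) = k}

end Grassmannian

/-- The set of connected components of a subset `S` of a topological space. -/
def components {X : Type*} [TopologicalSpace X] (S : Set X) : Set (Set X) :=
  {C | ∃ x ∈ S, C = connectedComponentIn S x}

end RestrictedGrassmannian

end

/-! Write `E` for the projection onto `L`, where `L` is `K` or `Kᗮ`. Everything is compared with the
set of projections `P` such that `P - E` is in `𝓑_p`.

Schatten conditions are handled through approximation numbers: `Tr (|T|^p)` is the sum of their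
`p`-th powers (`traceAbsPow_eq_tsum`). This makes `𝓑_p` an ideal closed under adjoints, and shows
that the Schatten norm dominates the operator norm.

The membership statements rest on short identities. For `𝔻₃` and `𝔻₄` it is `[P, E](P + E - 1) = (P
- E)(1 - (P - E)²)`: as `P - E` is compact, the last factor is invertible up to finite rank, so the
commutator controls `P - E`. For the Grassmannian it is `P - E = (1 - E)P - E(1 - P)`. For the orbit
it is `U E U* - E = [U, E] U*`.

The converse for the orbit and the description of the components use the index of a pair of closed
subspaces, `dim (M ∩ Lᗮ) - dim (L ∩ Mᗮ)`. For projections with compact difference it is the Fredholm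
index of the projection `M → L`. It is additive (`pairIndex_add`), and it vanishes when the
projections are at distance less than one.

The central construction is `exists_intertwiner`. For projections `P` and `Q` onto `M` and `L`, the
operator `B = QP + (1 - Q)(1 - P)` intertwines them, and `B*B = 1 - (P - Q)²` has kernel `(M ∩ Lᗮ) ⊕
(L ∩ Mᗮ)`. If the index is zero, a partial isometry `j` carries the first summand onto the second,
and `X = B + j - j*` is injective, intertwines `P` and `Q`, and differs from `1` by an element of
the ideal generated by `P - Q` and the finite rank operators. Its polar part is a unitary
conjugating `P` to `Q`. Since `X + X* = 2 B*B` is positive, the whole segment from `1` to `X` is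
invertible, and conjugating `P` along it gives a path of projections from `P` to `Q` that is
continuous in `‖·‖_p`.

Hence sets of constant index are connected, and local constancy of the index separates them. A shift
of an orthonormal basis adapted to `L` and `Lᗮ`, both infinite dimensional, realises every index; it
also reduces conjugation of `E` to an arbitrary `P` to the case of index zero. -/

namespace RestrictedGrassmannian

/-! ### Approximation numbers -/

section ApproxNumbers

universe u

variable {D E F G : Type u} [NormedAddCommGroup D] [InnerProductSpace ℂ D]
  [NormedAddCommGroup E] [InnerProductSpace ℂ E]
  [NormedAddCommGroup F] [InnerProductSpace ℂ F] [NormedAddCommGroup G] [InnerProductSpace ℂ G]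

/-- The `n`-th approximation number: the distance of `T` to the operators of rank at most `n`. -/
noncomputable def approxNumber (T : E →L[ℂ] F) (n : ℕ) : ℝ≥0∞ :=
  ⨅ S : {S : E →L[ℂ] F // (S : E →ₗ[ℂ] F).rank ≤ n}, ‖T - S.1‖ₑ

theorem approxNumber_le {T S : E →L[ℂ] F} {n : ℕ} (hS : (S : E →ₗ[ℂ] F).rank ≤ n) :
    approxNumber T n ≤ ‖T - S‖ₑ :=
  iInf_le (fun S : {S : E →L[ℂ] F // (S : E →ₗ[ℂ] F).rank ≤ n} => ‖T - S.1‖ₑ) ⟨S, hS⟩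

theorem approxNumber_lt_iff {T : E →L[ℂ] F} {n : ℕ} {t : ℝ≥0∞} :
    approxNumber T n < t ↔ ∃ S : E →L[ℂ] F, (S : E →ₗ[ℂ] F).rank ≤ n ∧ ‖T - S‖ₑ < t := by
  simp [approxNumber, iInf_lt_iff]

theorem approxNumber_antitone (T : E →L[ℂ] F) : Antitone (approxNumber T) := fun m n h =>
  le_iInf fun S => approxNumber_le (S.2.trans (by exact_mod_cast h))

theorem approxNumber_zero (T : E →L[ℂ] F) : approxNumber T 0 = ‖T‖ₑ := by
  refine le_antisymm ((approxNumber_le (S := 0) (by simp)).trans (by simp)) (le_iInf fun S => ?_)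
  have h0 : S.1 = 0 := by
    have h : (S.1 : E →ₗ[ℂ] F).rank ≤ 0 := by simpa using S.2
    rw [nonpos_iff_eq_zero, LinearMap.rank, Submodule.rank_eq_zero,
      LinearMap.range_eq_bot] at h
    exact ContinuousLinearMap.coe_inj.mp h
  simp [h0]

theorem approxNumber_le_enorm (T : E →L[ℂ] F) (n : ℕ) : approxNumber T n ≤ ‖T‖ₑ :=
  (approxNumber_antitone T (Nat.zero_le n)).trans (approxNumber_zero T).le

theorem approxNumber_ne_top (T : E →L[ℂ] F) (n : ℕ) : approxNumber T n ≠ ∞ :=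
  ((approxNumber_le_enorm T n).trans_lt enorm_lt_top).ne

theorem approxNumber_comp_le (A : F →L[ℂ] G) (T : E →L[ℂ] F) (B : D →L[ℂ] E) (n : ℕ) :
    approxNumber (A ∘L T ∘L B) n ≤ ‖A‖ₑ * ‖B‖ₑ * approxNumber T n := by
  have : Nonempty {S : E →L[ℂ] F // (S : E →ₗ[ℂ] F).rank ≤ n} := ⟨⟨0, by simp⟩⟩
  rw [approxNumber, approxNumber, ENNReal.mul_iInf
    (fun h => absurd h (ENNReal.mul_ne_top enorm_ne_top enorm_ne_top))]
  refine le_iInf fun S => ?_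
  have hr : ((A ∘L S.1 ∘L B : D →L[ℂ] G) : D →ₗ[ℂ] G).rank ≤ n :=
    ((LinearMap.rank_comp_le_right _ (A : F →ₗ[ℂ] G)).trans
      (LinearMap.rank_comp_le_left (B : D →ₗ[ℂ] E) (S.1 : E →ₗ[ℂ] F))).trans S.2
  refine (approxNumber_le hr).trans ?_
  have : A ∘L T ∘L B - A ∘L S.1 ∘L B = A ∘L (T - S.1) ∘L B := by
    simp [ContinuousLinearMap.comp_sub, ContinuousLinearMap.sub_comp]
  rw [this]
  calc ‖A ∘L (T - S.1) ∘L B‖ₑ ≤ ‖A‖ₑ * (‖T - S.1‖ₑ * ‖B‖ₑ) :=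
        (ContinuousLinearMap.opENorm_comp_le _ _).trans
          (mul_le_mul_right (ContinuousLinearMap.opENorm_comp_le _ _) _)
    _ = ‖A‖ₑ * ‖B‖ₑ * ‖T - S.1‖ₑ := by ring

/-- Ranks add, so approximants of rank `m` and `n` combine to one of rank at most `m + n`. -/
theorem approxNumber_add_le (S T : E →L[ℂ] F) (m n : ℕ) :
    approxNumber (S + T) (m + n) ≤ approxNumber S m + approxNumber T n := by
  rw [approxNumber.eq_def S, approxNumber.eq_def T, ENNReal.iInf_add]
  refine le_iInf fun A => ?_
  rw [ENNReal.add_iInf]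
  refine le_iInf fun B => ?_
  have hr : ((A.1 + B.1 : E →L[ℂ] F) : E →ₗ[ℂ] F).rank ≤ (m + n : ℕ) := by
    push_cast
    exact (LinearMap.rank_add_le _ _).trans (add_le_add A.2 B.2)
  refine (approxNumber_le hr).trans ?_
  rw [add_sub_add_comm]
  exact enorm_add_le (S - A.1) (T - B.1)

theorem isCompactOperator_of_finiteDimensional_range (T : E →L[ℂ] F)
    [FiniteDimensional ℂ (T : E →ₗ[ℂ] F).range] : IsCompactOperator T :=
  have : ProperSpace (T : E →ₗ[ℂ] F).range := FiniteDimensional.proper ℂ _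
  (isCompactOperator_of_locallyCompactSpace_rng
    ((T : E →ₗ[ℂ] F).range.subtypeL : (T : E →ₗ[ℂ] F).range →L[ℂ] F)).comp_clm
    (T.codRestrict (T : E →ₗ[ℂ] F).range fun x => ⟨x, rfl⟩)

/-- A compact operator into a Hilbert space is a norm limit of operators of finite rank. -/
theorem exists_finiteDimensional_range_norm_sub_lt {T : E →L[ℂ] F} (hT : IsCompactOperator T)
    {ε : ℝ} (hε : 0 < ε) :
    ∃ S : E →L[ℂ] F, FiniteDimensional ℂ (S : E →ₗ[ℂ] F).range ∧ ‖T - S‖ < ε := by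
  obtain ⟨C, hC, hCT⟩ := hT.image_closedBall_subset_compact 1
  obtain ⟨t, ht, htC⟩ := Metric.totallyBounded_iff.mp hC.totallyBounded (ε / 2) (half_pos hε)
  let V : Submodule ℂ F := Submodule.span ℂ t
  have : FiniteDimensional ℂ V := FiniteDimensional.span_of_finite ℂ ht
  -- `V` is spanned by a finite `ε / 2`-net of the image of the unit ball; the projection onto `V`
  -- is at least as close to `T x` as the nearest point of the net.
  refine ⟨V.starProjection ∘L T, ?_, ?_⟩
  · refine Submodule.finiteDimensional_of_le (S₂ := V) ?_
    rintro _ ⟨x, rfl⟩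
    exact V.starProjection_apply_mem (T x)
  · refine (ContinuousLinearMap.opNorm_le_of_unit_norm (half_pos hε).le fun x hx => ?_).trans_lt
      (half_lt_self hε)
    obtain ⟨y, hy, hxy⟩ := Set.mem_iUnion₂.mp (htC (hCT ⟨x, by simp [hx], rfl⟩))
    rw [Metric.mem_ball, dist_eq_norm] at hxy
    have hmin := Submodule.starProjection_minimal (U := V) (T x)
    change ‖T x - V.starProjection (T x)‖ ≤ ε / 2
    rw [hmin]
    exact (ciInf_le ⟨0, by rintro _ ⟨z, rfl⟩; exact norm_nonneg _⟩
      (⟨y, Submodule.subset_span hy⟩ : V)).trans hxy.le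

/-- Both conditions say that `T` is a norm limit of operators of finite rank. -/
theorem tendsto_approxNumber_iff [CompleteSpace F] {T : E →L[ℂ] F} :
    Filter.Tendsto (approxNumber T) Filter.atTop (nhds 0) ↔ IsCompactOperator T := by
  rw [ENNReal.tendsto_atTop_zero]
  constructor
  · intro h
    refine (isClosed_setOfPred_isCompactOperator (σ₁₂ := RingHom.id ℂ) (M₁ := E)
      (M₂ := F)).closure_subset (Metric.mem_closure_iff.mpr fun ε hε => ?_)
    obtain ⟨n, hn⟩ := h (ENNReal.ofReal (ε / 2)) (by simpa using hε)
    obtain ⟨S, hS, hTS⟩ := approxNumber_lt_iff.mp ((hn n le_rfl).trans_lt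
      ((ENNReal.ofReal_lt_ofReal_iff hε).mpr (half_lt_self hε)))
    have : FiniteDimensional ℂ (S : E →ₗ[ℂ] F).range :=
      Module.rank_lt_aleph0_iff.mp (hS.trans_lt (Cardinal.natCast_lt_aleph0))
    refine ⟨S, isCompactOperator_of_finiteDimensional_range S, ?_⟩
    rw [dist_eq_norm]
    rwa [← ofReal_norm, ENNReal.ofReal_lt_ofReal_iff hε] at hTS
  · intro h ε hε
    obtain ⟨r, hr, hrε⟩ := ENNReal.lt_iff_exists_nnreal_btwn.mp hε
    obtain ⟨S, hS, hTS⟩ := exists_finiteDimensional_range_norm_sub_lt h (ε := r)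
      (by exact_mod_cast hr)
    refine ⟨Module.finrank ℂ (S : E →ₗ[ℂ] F).range, fun n hn => ?_⟩
    refine (approxNumber_antitone T hn).trans ((approxNumber_le (S := S) ?_).trans ?_)
    · rw [Module.finrank_eq_rank]
    · refine le_trans ?_ hrε.le
      rw [← ofReal_norm]
      exact (ENNReal.ofReal_le_ofReal hTS.le).trans (by simp)

end ApproxNumbers

/-! ### Traces of positive operators and the Schatten class -/

section Trace

universe u

variable {E F : Type u} [NormedAddCommGroup E] [InnerProductSpace ℂ E] [CompleteSpace E]
  [NormedAddCommGroup F] [InnerProductSpace ℂ F] [CompleteSpace F]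

-- Parseval with values in `[0, ∞]`, so that double sums can be exchanged without summability
-- conditions.
omit [CompleteSpace E] in
theorem tsum_enorm_inner_sq {ι : Type*} (b : HilbertBasis ι ℂ E) (x : E) :
    ∑' i, ‖⟪b i, x⟫_ℂ‖ₑ ^ 2 = ‖x‖ₑ ^ 2 := by
  have h : HasSum (fun i => ‖⟪b i, x⟫_ℂ‖ ^ 2) (‖x‖ ^ 2) := by
    have h1 := (Complex.reCLM.hasSum (b.hasSum_inner_mul_inner x x))
    have h2 : Complex.reCLM ⟪x, x⟫_ℂ = ‖x‖ ^ 2 := by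
      simp [inner_self_eq_norm_sq_to_K, ← Complex.ofReal_pow]
    rw [h2] at h1
    convert h1 using 2 with i
    rw [← inner_conj_symm x (b i), Complex.conj_mul']
    simp [← Complex.ofReal_pow]
  have h' := ENNReal.ofReal_tsum_of_nonneg (fun i => by positivity) h.summable
  rw [h.tsum_eq] at h'
  rw [← ofReal_norm, ← ENNReal.ofReal_pow (norm_nonneg _), h']
  exact tsum_congr fun i => by rw [← ofReal_norm, ← ENNReal.ofReal_pow (norm_nonneg _)]

/-- The trace of `S* S` is the sum of the `‖S eᵢ‖²`, for every Hilbert basis. -/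
theorem tsum_enorm_apply_sq_eq {ι κ : Type*} (b : HilbertBasis ι ℂ E) (c : HilbertBasis κ ℂ E)
    {S : E →L[ℂ] E} (hS : IsSelfAdjoint S) :
    ∑' i, ‖S (b i)‖ₑ ^ 2 = ∑' k, ‖S (c k)‖ₑ ^ 2 := by
  -- Both sides expand to the double sum of `|⟪c k, S (b i)⟫|²`, taken in opposite orders.
  simp_rw [← tsum_enorm_inner_sq c (S (b _)), ← tsum_enorm_inner_sq b (S (c _))]
  rw [ENNReal.tsum_comm]
  refine tsum_congr fun k => tsum_congr fun i => ?_
  have h : ⟪S (c k), b i⟫_ℂ = ⟪c k, S (b i)⟫_ℂ := hS.isSymmetric (c k) (b i)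
  rw [← h, ← inner_conj_symm, RCLike.enorm_conj]

/-- Turns the trace of `A` into a Hilbert–Schmidt sum for the square root of `A`, where independence
of the basis is already known. -/
theorem re_inner_eq_norm_sqrt_sq {A : E →L[ℂ] E} (hA : 0 ≤ A) (x : E) :
    ENNReal.ofReal (RCLike.re ⟪x, A x⟫_ℂ) = ‖CFC.sqrt A x‖ₑ ^ 2 := by
  have h : CFC.sqrt A * CFC.sqrt A = A := CFC.sqrt_mul_sqrt_self A
  have hs : IsSelfAdjoint (CFC.sqrt A) := (CFC.sqrt_nonneg A).isSelfAdjoint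
  have h1 : ⟪x, A x⟫_ℂ = ⟪CFC.sqrt A x, CFC.sqrt A x⟫_ℂ := by
    conv_lhs => rw [← h]
    exact (hs.isSymmetric x (CFC.sqrt A x)).symm
  rw [h1, inner_self_eq_norm_sq, ENNReal.ofReal_pow (norm_nonneg _), ofReal_norm]

/-- The trace of a positive operator does not depend on the Hilbert basis. -/
theorem posTrace_eq_tsum {ι : Type*} (b : HilbertBasis ι ℂ E) {A : E →L[ℂ] E} (hA : 0 ≤ A) :
    posTrace A = ∑' i, ENNReal.ofReal (RCLike.re ⟪b i, A (b i)⟫_ℂ) := by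
  obtain ⟨c, hc⟩ := (exists_hilbertBasis ℂ E).choose_spec
  simp_rw [posTrace, re_inner_eq_norm_sqrt_sq hA, tsum_enorm_apply_sq_eq b c (CFC.sqrt_nonneg A).isSelfAdjoint, hc]

/-- The claim is clear for constants and the identity function, is stable under sums and products,
and is closed under uniform limits; Stone–Weierstrass gives all continuous functions. A nonzero `x`
places `r` in the spectrum, so that evaluation at `r` makes sense. -/
theorem cfc_apply_of_apply_eq_smul {A : E →L[ℂ] E} (hA : IsSelfAdjoint A) {x : E} {r : ℝ}
    (hx : A x = (r : ℂ) • x) {f : ℝ → ℝ} (hf : ContinuousOn f (spectrum ℝ A)) :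
    cfc f A x = (f r : ℂ) • x := by
  rcases eq_or_ne x 0 with rfl | hx0
  · simp
  have hr : r ∈ spectrum ℝ A := by
    intro h
    obtain ⟨u, hu⟩ := h
    have h0 : (u : E →L[ℂ] E) x = 0 := by
      rw [hu, sub_apply, hx, Algebra.algebraMap_eq_smul_one]
      simp
    apply hx0
    calc x = (↑u⁻¹ * ↑u : E →L[ℂ] E) x := by simp
      _ = 0 := by rw [mul_apply_eq_comp, h0, map_zero]
  rw [cfc_apply f A]
  have key : ∀ g : C(spectrum ℝ A, ℝ), cfcHom (R := ℝ) hA g x = (g ⟨r, hr⟩ : ℂ) • x := by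
    intro g
    refine ContinuousMap.induction_on_of_compact (𝕜 := ℝ) (p := fun g => cfcHom (R := ℝ) hA g x = (g ⟨r, hr⟩ : ℂ) • x) ?_ ?_ ?_ ?_ ?_ ?_ g
    · intro c
      have : ContinuousMap.const (spectrum ℝ A) c = algebraMap ℝ C(spectrum ℝ A, ℝ) c := rfl
      rw [this, AlgHomClass.commutes]
      simp [Algebra.algebraMap_eq_smul_one]
    · rw [cfcHom_id]
      simpa using hx
    · rw [star_trivial, cfcHom_id]
      simpa using hx
    · intro f g hf hg
      simp [hf, hg, add_smul]
    · intro f g hf hg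
      simp [hf, hg, mul_smul, smul_comm (f ⟨r, hr⟩)]
    · intro f hf
      have hcl : IsClosed {g : C(spectrum ℝ A, ℝ) | cfcHom (R := ℝ) hA g x = (g ⟨r, hr⟩ : ℂ) • x} := by
        refine isClosed_eq ?_ ?_
        · have := cfcHom_continuous (R := ℝ) hA
          fun_prop
        · fun_prop
      exact hcl.closure_subset (mem_closure_iff_frequently.mpr hf)
  exact key _

theorem rpow_apply_of_apply_eq_smul {A : E →L[ℂ] E} (hA : 0 ≤ A) {x : E} {r : ℝ}
    (hx : A x = (r : ℂ) • x) {p : ℝ} (hp : 0 ≤ p) :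
    CFC.rpow A p x = ((r ^ p : ℝ) : ℂ) • x := by
  have h : CFC.rpow A p = cfc (fun x : ℝ => x ^ p) A := CFC.rpow_eq_cfc_real hA
  rw [h]
  exact cfc_apply_of_apply_eq_smul hA.isSelfAdjoint hx
    ((Real.continuous_rpow_const hp).continuousOn)

theorem sqrt_apply_of_apply_eq_smul {A : E →L[ℂ] E} (hA : 0 ≤ A) {x : E} {r : ℝ}
    (hx : A x = (r : ℂ) • x) : CFC.sqrt A x = ((√r : ℝ) : ℂ) • x := by
  rw [CFC.sqrt_eq_rpow, Real.sqrt_eq_rpow]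
  exact rpow_apply_of_apply_eq_smul hA hx (by norm_num)

/-- A compact positive operator has a Hilbert basis of eigenvectors. -/
theorem exists_hilbertBasis_apply_eq_smul {A : E →L[ℂ] E} (hA : 0 ≤ A) (hc : IsCompactOperator A) :
    ∃ (ι : Type u) (b : HilbertBasis ι ℂ E) (r : ι → ℝ),
      (∀ i, 0 ≤ r i) ∧ ∀ i, A (b i) = (r i : ℂ) • b i := by
  have hpos := (ContinuousLinearMap.nonneg_iff_isPositive A).mp hA
  have hsymm : (A : E →ₗ[ℂ] E).IsSymmetric := hA.isSelfAdjoint.isSymmetric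
  have hcomp : ∀ μ : ℂ, CompleteSpace (Module.End.eigenspace (A : E →ₗ[ℂ] E) μ) := fun μ => by
    have : IsClosed (Module.End.eigenspace (A : E →ₗ[ℂ] E) μ : Set E) := by
      have : (Module.End.eigenspace (A : E →ₗ[ℂ] E) μ : Set E) = {x | A x = μ • x} := by
        ext x
        simp
      rw [this]
      exact isClosed_eq (by fun_prop) (by fun_prop)
    exact this.completeSpace_coe
  choose w c hwc using fun μ : ℂ => exists_hilbertBasis ℂ (Module.End.eigenspace (A : E →ₗ[ℂ] E) μ)
  let v : (Σ μ : ℂ, w μ) → E := fun a => (c a.1 a.2 : E)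
  have hv : Orthonormal ℂ v :=
    hsymm.orthogonalFamily_eigenspaces.orthonormal_sigma_orthonormal fun μ => (c μ).orthonormal
  -- The spectral theorem for compact self-adjoint operators: the eigenspaces, the kernel included,
  -- have no common orthogonal vector except zero.
  have hspan : (Submodule.span ℂ (Set.range v))ᗮ = ⊥ := by
    rw [eq_bot_iff, ← ContinuousLinearMap.orthogonalComplement_iSup_eigenspaces_eq_bot hc hsymm]
    intro x hx
    rw [← Submodule.iInf_orthogonal, Submodule.mem_iInf]
    intro μ
    rw [Submodule.mem_orthogonal]
    intro y hy
    have hd := (c μ).dense_span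
    have hy' : (⟨y, hy⟩ : Module.End.eigenspace (A : E →ₗ[ℂ] E) μ) ∈
        (Submodule.span ℂ (Set.range (c μ))).topologicalClosure := hd ▸ Submodule.mem_top
    have hcl : IsClosed {z : Module.End.eigenspace (A : E →ₗ[ℂ] E) μ | ⟪(z : E), x⟫_ℂ = 0} :=
      isClosed_eq (by fun_prop) (by fun_prop)
    refine closure_minimal (fun z hz => ?_) hcl hy'
    refine (Submodule.mem_orthogonal _ _).mp hx (z : E) ?_
    have := Submodule.mem_map_of_mem (f := (Module.End.eigenspace (A : E →ₗ[ℂ] E) μ).subtype) hz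
    rw [Submodule.map_span] at this
    refine Submodule.span_mono ?_ this
    rintro _ ⟨_, ⟨i, rfl⟩, rfl⟩
    exact ⟨⟨μ, i⟩, rfl⟩
  -- Recording the eigenvalue as a quadratic form makes its nonnegativity immediate; `h3` below
  -- shows that no imaginary part is lost.
  refine ⟨_, HilbertBasis.mkOfOrthogonalEqBot hv hspan, fun a => RCLike.re ⟪v a, A (v a)⟫_ℂ,
    fun a => hpos.re_inner_nonneg_right (v a), fun a => ?_⟩
  rw [HilbertBasis.coe_mkOfOrthogonalEqBot]
  have h1 : A (v a) = a.1 • v a := Module.End.mem_eigenspace_iff.mp (c a.1 a.2).2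
  have h2 : ⟪v a, A (v a)⟫_ℂ = a.1 := by
    rw [h1, inner_smul_right, inner_self_eq_norm_sq_to_K, hv.1 a]
    simp
  have h3 : ((RCLike.re ⟪v a, A (v a)⟫_ℂ : ℝ) : ℂ) = ⟪v a, A (v a)⟫_ℂ :=
    (Complex.conj_eq_iff_re (z := ⟪v a, A (v a)⟫_ℂ)).mp (by
      rw [inner_conj_symm]; exact hsymm (v a) (v a))
  rw [h3, h2, h1]

end Trace

/-! ### Approximation numbers and the eigenvalues of `|T|` -/

section Diagonal

universe u

variable {E F : Type u} [NormedAddCommGroup E] [InnerProductSpace ℂ E] [CompleteSpace E]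
  [NormedAddCommGroup F] [InnerProductSpace ℂ F] [CompleteSpace F]

theorem absOp_nonneg (T : E →L[ℂ] F) : 0 ≤ absOp T := CFC.sqrt_nonneg _

theorem adjoint_comp_self_nonneg (T : E →L[ℂ] F) : 0 ≤ T.adjoint ∘L T :=
  (ContinuousLinearMap.nonneg_iff_isPositive _).mpr T.isPositive_adjoint_comp_self

/-- Both squares equal `⟪x, T* T x⟫`. -/
theorem norm_absOp_apply (T : E →L[ℂ] F) (x : E) : ‖absOp T x‖ = ‖T x‖ := by
  have h1 := re_inner_eq_norm_sqrt_sq (adjoint_comp_self_nonneg T) x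
  rw [ContinuousLinearMap.comp_apply, ContinuousLinearMap.adjoint_inner_right,
    inner_self_eq_norm_sq, ENNReal.ofReal_pow (norm_nonneg _), ofReal_norm] at h1
  have h2 : ‖T x‖ₑ = ‖absOp T x‖ₑ := (ENNReal.pow_right_strictMono two_ne_zero).injective h1
  simpa using congrArg ENNReal.toReal h2.symm

/-- The operator `|T|` is diagonal in the Hilbert basis `b`, with eigenvalues `r`. -/
structure IsAbsDiagonal {ι : Type*} (T : E →L[ℂ] F) (b : HilbertBasis ι ℂ E) (r : ι → ℝ) : Prop where
  nonneg : ∀ i, 0 ≤ r i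
  apply_eq : ∀ i, absOp T (b i) = (r i : ℂ) • b i

namespace IsAbsDiagonal

variable {ι : Type*} {T : E →L[ℂ] F} {b : HilbertBasis ι ℂ E} {r : ι → ℝ}

theorem enorm_apply_sq (h : IsAbsDiagonal T b r) (x : E) :
    ‖T x‖ₑ ^ 2 = ∑' i, ENNReal.ofReal (r i) ^ 2 * ‖⟪b i, x⟫_ℂ‖ₑ ^ 2 := by
  rw [← enorm_norm, ← norm_absOp_apply, enorm_norm, ← tsum_enorm_inner_sq b]
  refine tsum_congr fun i => ?_
  have h1 : ⟪b i, absOp T x⟫_ℂ = ⟪absOp T (b i), x⟫_ℂ :=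
    ((absOp_nonneg T).isSelfAdjoint.isSymmetric (b i) x).symm
  rw [h1, h.apply_eq, inner_smul_left, Complex.conj_ofReal, enorm_mul, mul_pow,
    ← ofReal_norm (r i : ℂ), Complex.norm_real, Real.norm_of_nonneg (h.nonneg i)]

/-- Compress to the span `V` of the at most `n` vectors `b i` with `t < r i`: on `Vᗮ` every
eigenvalue that still occurs is at most `t`. -/
theorem approxNumber_le (h : IsAbsDiagonal T b r) {t : ℝ} {n : ℕ}
    (hn : {i | t < r i}.encard ≤ n) : approxNumber T n ≤ ENNReal.ofReal t := by
  obtain ⟨hfin, hcard⟩ := Set.encard_le_coe_iff_finite_ncard_le.mp hn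
  classical
  set s : Finset ι := hfin.toFinset with hs
  have hscard : s.card ≤ n := by rwa [← Set.ncard_eq_toFinset_card _ hfin]
  set V : Submodule ℂ E := Submodule.span ℂ (s.image b : Finset E) with hV
  have : FiniteDimensional ℂ V := FiniteDimensional.span_finset ℂ _
  have hr : ((T ∘L V.starProjection : E →L[ℂ] F) : E →ₗ[ℂ] F).rank ≤ n := by
    refine (LinearMap.rank_comp_le_right (V.starProjection : E →ₗ[ℂ] E) (T : E →ₗ[ℂ] F)).trans ?_
    refine (Submodule.rank_mono (t := V) ?_).trans
      ((rank_span_finset_le _).trans ?_)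
    · rintro _ ⟨x, rfl⟩
      exact V.starProjection_apply_mem x
    · exact_mod_cast Finset.card_image_le.trans hscard
  refine (RestrictedGrassmannian.approxNumber_le hr).trans
    (ContinuousLinearMap.opENorm_le_bound _ fun x => ?_)
  set y := x - V.starProjection x with hy
  have hyx : (T - T ∘L V.starProjection) x = T y := by simp [hy]
  have hyle : ‖y‖ₑ ≤ ‖x‖ₑ := by
    have : y = Vᗮ.starProjection x := by rw [Submodule.starProjection_orthogonal_val]
    rw [this, enorm_le_iff_norm_le]
    exact Vᗮ.norm_starProjection_apply_le x
  rw [hyx]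
  refine le_trans ?_ (mul_le_mul_right hyle _)
  rw [← ENNReal.pow_le_pow_left_iff two_ne_zero, mul_pow, h.enorm_apply_sq,
    ← tsum_enorm_inner_sq b y, ← ENNReal.tsum_mul_left]
  refine ENNReal.tsum_le_tsum fun i => ?_
  by_cases hi : t < r i
  · have hbi : b i ∈ V := Submodule.subset_span (by
      simp only [Finset.coe_image]
      exact ⟨i, by simpa [hs] using hi, rfl⟩)
    have : ⟪b i, y⟫_ℂ = 0 := 
      (Submodule.mem_orthogonal _ _).mp (V.sub_starProjection_mem_orthogonal x) _ hbi
    simp [this]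
  · gcongr
    exact not_lt.mp hi

/-- An operator of rank at most `n` kills a nonzero vector in the span of `n + 1` eigenvectors with
`t < r i`, and there `T` expands by at least the smallest of these `r i`. The minimum over finitely
many indices keeps the inequality strict. -/
theorem lt_approxNumber (h : IsAbsDiagonal T b r) {t : ℝ} (ht : 0 ≤ t) {n : ℕ}
    (hn : n < {i | t < r i}.encard) : ENNReal.ofReal t < approxNumber T n := by
  obtain ⟨s', hs', hcard⟩ := Set.exists_subset_encard_eq (Order.add_one_le_of_lt hn)
  have hfin : s'.Finite := Set.finite_of_encard_eq_coe (k := n + 1) (by exact_mod_cast hcard)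
  classical
  set s : Finset ι := hfin.toFinset with hs
  have hscard : s.card = n + 1 := by
    rw [hfin.encard_eq_coe_toFinset_card] at hcard
    exact_mod_cast hcard
  have hsr : ∀ i ∈ s, t < r i := fun i hi => hs' (by simpa [hs] using hi)
  have hne : s.Nonempty := Finset.card_pos.mp (by omega)
  obtain ⟨i₀, hi₀, hmin⟩ := s.exists_min_image r hne
  refine ((ENNReal.ofReal_lt_ofReal_iff (ht.trans_lt (hsr i₀ hi₀))).mpr (hsr i₀ hi₀)).trans_le ?_
  refine le_iInf fun S => ?_
  set V : Submodule ℂ E := Submodule.span ℂ (Set.range fun i : s => b i) with hV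
  have hVdim : Module.finrank ℂ V = n + 1 := by
    have hli : LinearIndependent ℂ fun i : s => b i :=
      b.orthonormal.linearIndependent.comp _ Subtype.val_injective
    rw [hV, finrank_span_eq_card hli]
    simpa using hscard
  have hVfin : FiniteDimensional ℂ V := FiniteDimensional.span_of_finite ℂ (Set.finite_range _)
  have hSfin : FiniteDimensional ℂ (S.1 : E →ₗ[ℂ] F).range :=
    Module.rank_lt_aleph0_iff.mp (S.2.trans_lt (Cardinal.natCast_lt_aleph0))
  have hSdim : Module.finrank ℂ (S.1 : E →ₗ[ℂ] F).range ≤ n :=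
    Module.finrank_le_of_rank_le S.2
  obtain ⟨⟨v, hvV⟩, hv, hv0⟩ := Submodule.exists_mem_ne_zero_of_ne_bot
    (LinearMap.ker_ne_bot_of_finrank_lt
      (f := (S.1 : E →ₗ[ℂ] F).rangeRestrict ∘ₗ V.subtype) (by omega))
  have hv0' : v ≠ 0 := fun h => hv0 (Subtype.ext h)
  have hSv : S.1 v = 0 := congrArg Subtype.val (LinearMap.mem_ker.mp hv)
  have hperp : ∀ i ∉ s, ⟪b i, v⟫_ℂ = 0 := by
    intro i hi
    refine Submodule.span_induction (p := fun w _ => ⟪b i, w⟫_ℂ = 0) ?_ (by simp) ?_ ?_ hvV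
    · rintro _ ⟨j, rfl⟩
      exact b.orthonormal.2 fun hij => hi (hij ▸ j.2)
    · intro x y _ _ hx hy
      rw [inner_add_right, hx, hy, add_zero]
    · intro a x _ hx
      rw [inner_smul_right, hx, mul_zero]
  have key : ENNReal.ofReal (r i₀) * ‖v‖ₑ ≤ ‖T - S.1‖ₑ * ‖v‖ₑ := by
    refine le_trans ?_ ((T - S.1).le_opENorm v)
    have : (T - S.1) v = T v := by simp [hSv]
    rw [this, ← ENNReal.pow_le_pow_left_iff two_ne_zero, mul_pow, h.enorm_apply_sq,
      ← tsum_enorm_inner_sq b v, ← ENNReal.tsum_mul_left]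
    refine ENNReal.tsum_le_tsum fun i => ?_
    by_cases hi : i ∈ s
    · gcongr
      exact hmin i hi
    · simp [hperp i hi]
  exact (ENNReal.mul_le_mul_iff_left (by simpa using hv0') enorm_ne_top).mp key

theorem approxNumber_le_iff (h : IsAbsDiagonal T b r) {t : ℝ} (ht : 0 ≤ t) {n : ℕ} :
    approxNumber T n ≤ ENNReal.ofReal t ↔ {i | t < r i}.encard ≤ n :=
  ⟨fun h' => not_lt.mp fun hn => (h.lt_approxNumber ht hn).not_ge h', h.approxNumber_le⟩

/-- The `n`-th approximation number exceeds `t` exactly when `n` is less than the number of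
eigenvalues above `t`. So the two families have the same distribution function, without sorting the
eigenvalues. -/
theorem encard_lt_approxNumber (h : IsAbsDiagonal T b r) {t : ℝ} (ht : 0 ≤ t) :
    {n : ℕ | t < (approxNumber T n).toReal}.encard = {i | t < r i}.encard := by
  have h1 : ∀ n : ℕ, t < (approxNumber T n).toReal ↔ n < {i | t < r i}.encard := by
    intro n
    rw [← not_le, ← not_le, ← h.approxNumber_le_iff ht, ENNReal.le_ofReal_iff_toReal_le
      (approxNumber_ne_top T n) ht]
  simp_rw [h1]
  generalize {i | t < r i}.encard = k
  induction k using ENat.recTopCoe with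
  | top => simp
  | coe k =>
    have : {n : ℕ | (n : ℕ∞) < (k : ℕ∞)} = (Finset.range k : Finset ℕ) := by
      ext n; simp
    rw [this, Set.encard_coe_eq_coe_finsetCard, Finset.card_range]

/-- The `p`-th power sums of the approximation numbers of `T` and of the eigenvalues of `|T|`
coincide. -/
theorem tsum_approxNumber_rpow (h : IsAbsDiagonal T b r) {p : ℝ} (hp : 0 < p) :
    ∑' n, approxNumber T n ^ p = ∑' i, ENNReal.ofReal (r i ^ p) := by
  -- The layer cake formula for counting measure expresses both sums through the distribution
  -- functions.
  let _ : MeasurableSpace ι := ⊤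
  have e1 := MeasureTheory.lintegral_rpow_eq_lintegral_meas_lt_mul
    (MeasureTheory.Measure.count : MeasureTheory.Measure ι) (f := r)
    (Filter.Eventually.of_forall h.nonneg) (measurable_from_top.aemeasurable) hp
  have e2 := MeasureTheory.lintegral_rpow_eq_lintegral_meas_lt_mul
    (MeasureTheory.Measure.count : MeasureTheory.Measure ℕ)
    (f := fun n => (approxNumber T n).toReal)
    (Filter.Eventually.of_forall fun n => ENNReal.toReal_nonneg)
    (measurable_from_top.aemeasurable) hp
  rw [MeasureTheory.lintegral_count] at e1 e2
  have e3 : ∀ n, approxNumber T n ^ p = ENNReal.ofReal ((approxNumber T n).toReal ^ p) := fun n => by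
    rw [← ENNReal.ofReal_rpow_of_nonneg ENNReal.toReal_nonneg hp.le,
      ENNReal.ofReal_toReal (approxNumber_ne_top T n)]
  simp_rw [e3]
  rw [e1, e2]
  congr 1
  refine MeasureTheory.setLIntegral_congr_fun measurableSet_Ioi fun t ht => ?_
  rw [MeasureTheory.Measure.count_apply MeasurableSpace.measurableSet_top,
    MeasureTheory.Measure.count_apply MeasurableSpace.measurableSet_top,
    h.encard_lt_approxNumber (le_of_lt ht)]

end IsAbsDiagonal

theorem exists_isAbsDiagonal_of_isCompactOperator {T : E →L[ℂ] F} (hT : IsCompactOperator T) :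
    ∃ (ι : Type u) (b : HilbertBasis ι ℂ E) (r : ι → ℝ), IsAbsDiagonal T b r := by
  obtain ⟨ι, b, r, hr, hb⟩ := exists_hilbertBasis_apply_eq_smul (adjoint_comp_self_nonneg T)
    (hT.clm_comp T.adjoint)
  exact ⟨ι, b, fun i => √(r i), fun i => Real.sqrt_nonneg _,
    fun i => sqrt_apply_of_apply_eq_smul (adjoint_comp_self_nonneg T) (hb i)⟩

theorem rpow_nonneg (A : E →L[ℂ] E) (p : ℝ) : 0 ≤ CFC.rpow A p :=
  CFC.rpow_nonneg (a := A) (y := p)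

theorem IsAbsDiagonal.traceAbsPow_eq {ι : Type*} {T : E →L[ℂ] F} {b : HilbertBasis ι ℂ E}
    {r : ι → ℝ} (h : IsAbsDiagonal T b r) {p : ℝ} (hp : 0 ≤ p) :
    traceAbsPow p T = ∑' i, ENNReal.ofReal (r i ^ p) := by
  rw [traceAbsPow, posTrace_eq_tsum b (rpow_nonneg _ p)]
  refine tsum_congr fun i => ?_
  rw [rpow_apply_of_apply_eq_smul (absOp_nonneg T) (h.apply_eq i) hp, inner_smul_right,
    inner_self_eq_norm_sq_to_K, b.orthonormal.1 i]
  simp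

/-- A positive operator of finite trace is compact. -/
theorem isCompactOperator_of_posTrace_lt_top {A : E →L[ℂ] E} (hA : 0 ≤ A) (h : posTrace A < ∞) :
    IsCompactOperator A := by
  obtain ⟨w, b, -⟩ := exists_hilbertBasis ℂ E
  set R := CFC.sqrt A with hR
  have hRs : IsSelfAdjoint R := (CFC.sqrt_nonneg A).isSelfAdjoint
  have hRR : A = R ∘L R := (CFC.sqrt_mul_sqrt_self A).symm
  rw [posTrace_eq_tsum b hA] at h
  simp_rw [re_inner_eq_norm_sqrt_sq hA, ← hR] at h
  -- `R` is Hilbert–Schmidt, since `h` bounds the sum of the `‖R (b i)‖²`. Projecting its values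
  -- onto the span of finitely many `b i` leaves an error controlled by the tail of that sum.
  suffices hc : IsCompactOperator R by
    rw [hRR]
    exact hc.clm_comp R
  refine (isClosed_setOfPred_isCompactOperator (σ₁₂ := RingHom.id ℂ) (M₁ := E)
    (M₂ := E)).closure_subset (Metric.mem_closure_iff.mpr fun ε hε => ?_)
  have hε2 : 0 < ENNReal.ofReal (ε / 2) ^ 2 := by positivity
  obtain ⟨s, hs⟩ := ((ENNReal.tendsto_tsum_compl_atTop_zero h.ne).eventually_le_const hε2).exists
  classical
  set V : Submodule ℂ E := Submodule.span ℂ (s.image b : Finset E) with hV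
  have : FiniteDimensional ℂ V := FiniteDimensional.span_finset ℂ _
  have hfin : FiniteDimensional ℂ ((V.starProjection ∘L R : E →L[ℂ] E) : E →ₗ[ℂ] E).range := by
    refine Submodule.finiteDimensional_of_le (S₂ := V) ?_
    rintro _ ⟨x, rfl⟩
    exact V.starProjection_apply_mem (R x)
  refine ⟨V.starProjection ∘L R, isCompactOperator_of_finiteDimensional_range _, ?_⟩
  rw [dist_eq_norm]
  suffices hle : ‖R - V.starProjection ∘L R‖ₑ ≤ ENNReal.ofReal (ε / 2) by
    rw [← ofReal_norm, ENNReal.ofReal_le_ofReal_iff (half_pos hε).le] at hle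
    exact hle.trans_lt (half_lt_self hε)
  refine ContinuousLinearMap.opENorm_le_bound _ fun x => ?_
  rw [← ENNReal.pow_le_pow_left_iff two_ne_zero, mul_pow, ← tsum_enorm_inner_sq b]
  have hzero : ∀ i ∈ s, ⟪b i, (R - V.starProjection ∘L R) x⟫_ℂ = 0 := fun i hi =>
    (Submodule.mem_orthogonal _ _).mp (V.sub_starProjection_mem_orthogonal (R x)) _
      (Submodule.subset_span (Finset.mem_coe.mpr (Finset.mem_image_of_mem b hi)))
  have hle : ∀ i, ‖⟪b i, (R - V.starProjection ∘L R) x⟫_ℂ‖ₑ ^ 2 ≤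
      (if i ∈ s then 0 else ‖R (b i)‖ₑ ^ 2) * ‖x‖ₑ ^ 2 := by
    intro i
    split_ifs with hi
    · rw [hzero i hi]
      simp
    · have hVi : V ≤ (ℂ ∙ b i)ᗮ := by
        refine Submodule.span_le.mpr fun y hy => ?_
        obtain ⟨j, hj, rfl⟩ := Finset.mem_image.mp (Finset.mem_coe.mp hy)
        exact Submodule.mem_orthogonal_singleton_iff_inner_right.mpr
          (b.orthonormal.2 fun hij => hi (hij ▸ hj))
      have h0 : ⟪b i, V.starProjection (R x)⟫_ℂ = 0 :=
        Submodule.mem_orthogonal_singleton_iff_inner_right.mp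
          (hVi (V.starProjection_apply_mem (R x)))
      have h1 : ⟪R (b i), x⟫_ℂ = ⟪b i, R x⟫_ℂ := hRs.isSymmetric (b i) x
      rw [sub_apply, ContinuousLinearMap.comp_apply, inner_sub_right, h0, sub_zero, ← h1,
        ← mul_pow]
      gcongr
      rw [← ofReal_norm, ← ofReal_norm, ← ofReal_norm, ← ENNReal.ofReal_mul (norm_nonneg _)]
      exact ENNReal.ofReal_le_ofReal (norm_inner_le_norm _ _)
  refine (ENNReal.tsum_le_tsum hle).trans ?_
  rw [ENNReal.tsum_mul_right]
  gcongr
  refine le_trans (le_of_eq ?_) hs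
  refine Eq.trans (tsum_congr fun i => ?_)
    (tsum_subtype {i | i ∉ s} fun i => ‖R (b i)‖ₑ ^ 2).symm
  by_cases hi : i ∈ s <;> simp [hi]

/-- The operator `|T|^p` has finite trace, so it is compact and has an eigenbasis. Its `p`-th root
is `|T|`, which is therefore diagonal in the same basis, and the approximation numbers of `T` are
`p`-summable. -/
theorem isCompactOperator_of_isSchatten {p : ℝ} (hp : 0 < p) {T : E →L[ℂ] F}
    (hT : IsSchatten p T) : IsCompactOperator T := by
  set A := absOp T with hA
  have hC : 0 ≤ CFC.rpow A p := rpow_nonneg A p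
  obtain ⟨ι, b, r, hr, hb⟩ := exists_hilbertBasis_apply_eq_smul hC
    (isCompactOperator_of_posTrace_lt_top hC hT)
  have hroot : CFC.rpow (CFC.rpow A p) p⁻¹ = A := by
    have := CFC.rpow_rpow_of_exponent_nonneg A p p⁻¹ hp.le (inv_nonneg.mpr hp.le) (absOp_nonneg T)
    rw [mul_inv_cancel₀ hp.ne', CFC.rpow_one A (absOp_nonneg T)] at this
    exact this
  have hdiag : IsAbsDiagonal T b fun i => r i ^ p⁻¹ := by
    refine ⟨fun i => Real.rpow_nonneg (hr i) _, fun i => ?_⟩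
    rw [← hA, ← hroot]
    exact rpow_apply_of_apply_eq_smul hC (hb i) (inv_nonneg.mpr hp.le)
  have hsum := hdiag.traceAbsPow_eq hp.le
  rw [← hdiag.tsum_approxNumber_rpow hp] at hsum
  rw [← tendsto_approxNumber_iff]
  have h0 := ENNReal.tendsto_atTop_zero_of_tsum_ne_top (hsum ▸ hT.ne)
  have h1 := (ENNReal.continuous_rpow_const (y := p⁻¹)).tendsto 0 |>.comp h0
  rw [ENNReal.zero_rpow_of_pos (inv_pos.mpr hp)] at h1
  refine h1.congr fun n => ?_
  rw [Function.comp_apply, ← ENNReal.rpow_mul, mul_inv_cancel₀ hp.ne', ENNReal.rpow_one]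

/-- `Tr (|T|^p)` is the `p`-th power sum of the approximation numbers. -/
theorem traceAbsPow_eq_tsum {p : ℝ} (hp : 0 < p) (T : E →L[ℂ] F) :
    traceAbsPow p T = ∑' n, approxNumber T n ^ p := by
  by_cases hT : IsCompactOperator T
  · obtain ⟨ι, b, r, h⟩ := exists_isAbsDiagonal_of_isCompactOperator hT
    rw [h.traceAbsPow_eq hp.le, h.tsum_approxNumber_rpow hp]
  -- Without compactness there is no eigenbasis, but both sides are infinite, since finiteness of
  -- either would force compactness.
  · have h1 : traceAbsPow p T = ∞ := by
      by_contra h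
      exact hT (isCompactOperator_of_isSchatten hp (lt_top_iff_ne_top.mpr h))
    have h2 : ∑' n, approxNumber T n ^ p = ∞ := by
      by_contra h
      refine hT (tendsto_approxNumber_iff.mp ?_)
      have h0 := ENNReal.tendsto_atTop_zero_of_tsum_ne_top h
      have h1 := (ENNReal.continuous_rpow_const (y := p⁻¹)).tendsto 0 |>.comp h0
      rw [ENNReal.zero_rpow_of_pos (inv_pos.mpr hp)] at h1
      refine h1.congr fun n => ?_
      rw [Function.comp_apply, ← ENNReal.rpow_mul, mul_inv_cancel₀ hp.ne', ENNReal.rpow_one]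
    rw [h1, h2]

end Diagonal

/-! ### The Schatten classes as operator ideals -/

section SchattenIdeal

universe u

variable {D E F G : Type u} [NormedAddCommGroup D] [InnerProductSpace ℂ D] [CompleteSpace D]
  [NormedAddCommGroup E] [InnerProductSpace ℂ E] [CompleteSpace E]
  [NormedAddCommGroup F] [InnerProductSpace ℂ F] [CompleteSpace F]
  [NormedAddCommGroup G] [InnerProductSpace ℂ G] [CompleteSpace G] {p : ℝ}

theorem traceAbsPow_comp_le (hp : 0 < p) (A : F →L[ℂ] G) (T : E →L[ℂ] F) (B : D →L[ℂ] E) :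
    traceAbsPow p (A ∘L T ∘L B) ≤ (‖A‖ₑ * ‖B‖ₑ) ^ p * traceAbsPow p T := by
  rw [traceAbsPow_eq_tsum hp, traceAbsPow_eq_tsum hp, ← ENNReal.tsum_mul_left]
  refine ENNReal.tsum_le_tsum fun n => ?_
  rw [← ENNReal.mul_rpow_of_nonneg _ _ hp.le]
  exact ENNReal.rpow_le_rpow (approxNumber_comp_le A T B n) hp.le

/-- The approximation numbers of `S + T` at `2n` and `2n + 1` are at most the sum of those of `S`
and `T` at `n`. The factor `2` counts even and odd indices, and `2 ^ (p - 1)` comes from convexity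
of the power. This crude bound replaces Minkowski's inequality: only finiteness and limits at zero
are needed. -/
theorem traceAbsPow_add_le (hp : 1 ≤ p) (S T : E →L[ℂ] F) :
    traceAbsPow p (S + T) ≤ 2 * 2 ^ (p - 1) * (traceAbsPow p S + traceAbsPow p T) := by
  have hp0 : 0 < p := one_pos.trans_le hp
  rw [traceAbsPow_eq_tsum hp0, traceAbsPow_eq_tsum hp0, traceAbsPow_eq_tsum hp0,
    ← ENNReal.tsum_add, mul_assoc, two_mul, ← ENNReal.tsum_mul_left,
    ← tsum_even_add_odd (f := fun n => approxNumber (S + T) n ^ p) ENNReal.summable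
      ENNReal.summable]
  have h : ∀ n, approxNumber (S + T) (2 * n) ^ p ≤
      2 ^ (p - 1) * (approxNumber S n ^ p + approxNumber T n ^ p) := fun n => by
    rw [two_mul]
    exact (ENNReal.rpow_le_rpow (approxNumber_add_le S T n n) hp0.le).trans
      (ENNReal.rpow_add_le_mul_rpow_add_rpow _ _ hp)
  refine add_le_add (ENNReal.tsum_le_tsum h) (ENNReal.tsum_le_tsum fun n => le_trans ?_ (h n))
  exact ENNReal.rpow_le_rpow (approxNumber_antitone _ (Nat.le_succ _)) hp0.le

/-- The left side is the term of index `0`. -/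
theorem enorm_rpow_le_traceAbsPow (hp : 0 < p) (T : E →L[ℂ] F) : ‖T‖ₑ ^ p ≤ traceAbsPow p T := by
  rw [traceAbsPow_eq_tsum hp, ← approxNumber_zero T]
  exact ENNReal.le_tsum 0

theorem schattenNorm_nonneg (T : E →L[ℂ] F) : 0 ≤ schattenNorm p T :=
  Real.rpow_nonneg ENNReal.toReal_nonneg _

theorem norm_le_schattenNorm (hp : 0 < p) {T : E →L[ℂ] F} (hT : IsSchatten p T) :
    ‖T‖ ≤ schattenNorm p T := by
  have h := ENNReal.toReal_mono hT.ne (enorm_rpow_le_traceAbsPow hp T)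
  rw [← ENNReal.toReal_rpow, toReal_enorm] at h
  rw [schattenNorm, one_div]
  exact (Real.le_rpow_inv_iff_of_pos (norm_nonneg _) ENNReal.toReal_nonneg hp).mpr h

theorem schattenNorm_comp_le (hp : 0 < p) (A : F →L[ℂ] G) {T : E →L[ℂ] F} (hT : IsSchatten p T)
    (B : D →L[ℂ] E) : schattenNorm p (A ∘L T ∘L B) ≤ ‖A‖ * ‖B‖ * schattenNorm p T := by
  have hfin : (‖A‖ₑ * ‖B‖ₑ) ^ p ≠ ∞ :=
    ENNReal.rpow_ne_top_of_nonneg hp.le (ENNReal.mul_ne_top enorm_ne_top enorm_ne_top)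
  have h := ENNReal.toReal_mono (ENNReal.mul_ne_top hfin hT.ne) (traceAbsPow_comp_le hp A T B)
  rw [ENNReal.toReal_mul, ← ENNReal.toReal_rpow, ENNReal.toReal_mul, toReal_enorm,
    toReal_enorm] at h
  refine (Real.rpow_le_rpow ENNReal.toReal_nonneg h (by positivity)).trans (le_of_eq ?_)
  rw [Real.mul_rpow (by positivity) ENNReal.toReal_nonneg, ← Real.rpow_mul (by positivity),
    mul_one_div_cancel hp.ne', Real.rpow_one, schattenNorm]

namespace IsSchatten

theorem comp (hp : 0 < p) (A : F →L[ℂ] G) {T : E →L[ℂ] F} (hT : IsSchatten p T)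
    (B : D →L[ℂ] E) : IsSchatten p (A ∘L T ∘L B) :=
  (traceAbsPow_comp_le hp A T B).trans_lt (ENNReal.mul_lt_top (lt_top_iff_ne_top.mpr
    (ENNReal.rpow_ne_top_of_nonneg hp.le (ENNReal.mul_ne_top enorm_ne_top enorm_ne_top))) hT)

theorem clm_comp (hp : 0 < p) (A : F →L[ℂ] G) {T : E →L[ℂ] F} (hT : IsSchatten p T) :
    IsSchatten p (A ∘L T) := by
  simpa using hT.comp hp A (ContinuousLinearMap.id ℂ E)

theorem comp_clm (hp : 0 < p) {T : E →L[ℂ] F} (hT : IsSchatten p T) (B : D →L[ℂ] E) :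
    IsSchatten p (T ∘L B) := by
  simpa using hT.comp hp (ContinuousLinearMap.id ℂ F) B

theorem mul_left (hp : 0 < p) (A : E →L[ℂ] E) {T : E →L[ℂ] E} (hT : IsSchatten p T) :
    IsSchatten p (A * T) := hT.clm_comp hp A

theorem mul_right (hp : 0 < p) {T : E →L[ℂ] E} (hT : IsSchatten p T) (B : E →L[ℂ] E) :
    IsSchatten p (T * B) := hT.comp_clm hp B

theorem neg (hp : 0 < p) {T : E →L[ℂ] F} (hT : IsSchatten p T) : IsSchatten p (-T) := by
  simpa using hT.clm_comp hp (-ContinuousLinearMap.id ℂ F)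

theorem add (hp : 1 ≤ p) {S T : E →L[ℂ] F} (hS : IsSchatten p S) (hT : IsSchatten p T) :
    IsSchatten p (S + T) :=
  (traceAbsPow_add_le hp S T).trans_lt (ENNReal.mul_lt_top
    (ENNReal.mul_lt_top (by simp) (lt_top_iff_ne_top.mpr
      (ENNReal.rpow_ne_top_of_nonneg (by linarith) (by simp)))) (ENNReal.add_lt_top.mpr ⟨hS, hT⟩))

theorem sub (hp : 1 ≤ p) {S T : E →L[ℂ] F} (hS : IsSchatten p S) (hT : IsSchatten p T) :
    IsSchatten p (S - T) := by
  rw [sub_eq_add_neg]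
  exact hS.add hp (hT.neg (one_pos.trans_le hp))

/-- The approximation numbers vanish from the rank of `T` onwards, so the sum is finite. -/
theorem of_finiteDimensional_range (hp : 0 < p) {T : E →L[ℂ] F}
    (hT : FiniteDimensional ℂ (T : E →ₗ[ℂ] F).range) : IsSchatten p T := by
  rw [IsSchatten, traceAbsPow_eq_tsum hp,
    tsum_eq_sum (s := Finset.range (Module.finrank ℂ (T : E →ₗ[ℂ] F).range))]
  · exact ENNReal.sum_lt_top.mpr fun n _ => lt_top_iff_ne_top.mpr
      (ENNReal.rpow_ne_top_of_nonneg hp.le (approxNumber_ne_top T n))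
  · intro n hn
    have h0 : approxNumber T n = 0 := by
      refine nonpos_iff_eq_zero.mp ((approxNumber_le (S := T) ?_).trans (by rw [sub_self, ← ofReal_norm]; simp))
      rw [LinearMap.rank, ← Module.finrank_eq_rank]
      exact_mod_cast not_lt.mp fun h => hn (Finset.mem_range.mpr h)
    rw [h0, ENNReal.zero_rpow_of_pos hp]

theorem zero (hp : 0 < p) : IsSchatten p (0 : E →L[ℂ] F) :=
  of_finiteDimensional_range hp (by
    rw [ContinuousLinearMap.toLinearMap_zero, LinearMap.range_zero]; infer_instance)

end IsSchatten

end SchattenIdeal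

/-! ### The index of linear maps with finite dimensional kernel and cokernel -/

section LinearIndex

variable {V W X : Type*} [AddCommGroup V] [Module ℂ V] [AddCommGroup W] [Module ℂ W]
  [AddCommGroup X] [Module ℂ X]

/-- The kernel and the cokernel of `f` have finite dimension. -/
structure HasIndex (f : V →ₗ[ℂ] W) : Prop where
  finite_ker : FiniteDimensional ℂ f.ker
  finite_coker : FiniteDimensional ℂ (W ⧸ f.range)

/-- The index `dim ker f - dim coker f`. -/
noncomputable def linearIndex (f : V →ₗ[ℂ] W) : ℤ :=
  (Module.finrank ℂ f.ker : ℤ) - (Module.finrank ℂ (W ⧸ f.range) : ℤ)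

theorem HasIndex.of_bijective {f : V →ₗ[ℂ] W} (hf : Function.Bijective f) : HasIndex f := by
  refine ⟨?_, ?_⟩
  · rw [LinearMap.ker_eq_bot.mpr hf.1]; infer_instance
  · rw [LinearMap.range_eq_top.mpr hf.2]; infer_instance

theorem linearIndex_of_bijective {f : V →ₗ[ℂ] W} (hf : Function.Bijective f) :
    linearIndex f = 0 := by
  rw [linearIndex, LinearMap.ker_eq_bot.mpr hf.1, LinearMap.range_eq_top.mpr hf.2]
  simp [Module.finrank_zero_of_subsingleton]

theorem finiteDimensional_of_ker_range (f : V →ₗ[ℂ] W) [FiniteDimensional ℂ f.ker]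
    [FiniteDimensional ℂ f.range] : FiniteDimensional ℂ V :=
  have : FiniteDimensional ℂ (V ⧸ f.ker) := f.quotKerEquivRange.symm.finiteDimensional
  Module.Finite.of_submodule_quotient f.ker

/-- The sequence `0 → ker f → ker (g f) → ker g → coker f → coker (g f) → coker g → 0` is exact, so
the alternating sum of the dimensions is zero. The maps `φ`, `ψ`, `χ`, `θ` are its inner arrows, and
rank–nullity is applied to each. -/
theorem linearIndex_comp {f : V →ₗ[ℂ] W} {g : W →ₗ[ℂ] X} (hf : HasIndex f) (hg : HasIndex g) :
    HasIndex (g ∘ₗ f) ∧ linearIndex (g ∘ₗ f) = linearIndex g + linearIndex f := by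
  have := hf.finite_ker
  have := hf.finite_coker
  have := hg.finite_ker
  have := hg.finite_coker
  -- kernels: `0 → ker f → ker (g f) → ker g ∩ range f → 0`
  let φ : (g ∘ₗ f).ker →ₗ[ℂ] g.ker := f.restrict fun x hx => by simpa using hx
  let ι : φ.ker ≃ₗ[ℂ] f.ker :=
    { toFun := fun x => ⟨x.1.1, LinearMap.mem_ker.mpr (congrArg Subtype.val (LinearMap.mem_ker.mp x.2))⟩
      map_add' := fun _ _ => rfl
      map_smul' := fun _ _ => rfl
      invFun := fun x => ⟨⟨x.1, by simp [LinearMap.mem_ker.mp x.2]⟩,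
        LinearMap.mem_ker.mpr (Subtype.ext (LinearMap.mem_ker.mp x.2))⟩
      left_inv := fun _ => rfl
      right_inv := fun _ => rfl }
  have hφ : FiniteDimensional ℂ φ.ker := ι.symm.finiteDimensional
  have hk : FiniteDimensional ℂ (g ∘ₗ f).ker := finiteDimensional_of_ker_range φ
  have e1 := φ.finrank_range_add_finrank_ker
  rw [ι.finrank_eq] at e1
  -- `ψ : ker g → coker f`, whose kernel is `ker g ∩ range f`
  let ψ : g.ker →ₗ[ℂ] W ⧸ f.range := f.range.mkQ ∘ₗ g.ker.subtype
  have hψ : ψ.ker = φ.range := by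
    ext y
    simp only [ψ, φ, LinearMap.mem_ker, LinearMap.comp_apply, Submodule.mkQ_apply,
      Submodule.Quotient.mk_eq_zero, LinearMap.mem_range, Submodule.subtype_apply]
    constructor
    · rintro ⟨x, hx⟩
      exact ⟨⟨x, by simp [hx]⟩, Subtype.ext hx⟩
    · rintro ⟨x, hx⟩
      exact ⟨x, congrArg Subtype.val hx⟩
  have e2 := ψ.finrank_range_add_finrank_ker
  rw [hψ] at e2
  -- `χ : coker f → coker (g f)`
  let χ : (W ⧸ f.range) →ₗ[ℂ] X ⧸ (g ∘ₗ f).range :=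
    f.range.mapQ (g ∘ₗ f).range g (by rintro _ ⟨x, rfl⟩; exact ⟨x, rfl⟩)
  have hχ : χ.ker = ψ.range := by
    ext y
    obtain ⟨w, rfl⟩ := Submodule.mkQ_surjective _ y
    simp only [χ, ψ, LinearMap.mem_ker, Submodule.mkQ_apply, Submodule.mapQ_apply,
      Submodule.Quotient.mk_eq_zero, LinearMap.mem_range, LinearMap.comp_apply,
      Submodule.subtype_apply]
    constructor
    · rintro ⟨x, hx⟩
      refine ⟨⟨w - f x, by simp [hx]⟩, ?_⟩
      rw [Submodule.Quotient.eq]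
      exact ⟨-x, by simp⟩
    · rintro ⟨⟨z, hz⟩, hzw⟩
      obtain ⟨x, hx⟩ := (Submodule.Quotient.eq _).mp hzw
      refine ⟨-x, ?_⟩
      rw [map_neg, hx, map_neg, map_sub, LinearMap.mem_ker.mp hz]
      simp
  have e3 := χ.finrank_range_add_finrank_ker
  rw [hχ] at e3
  -- `θ : coker (g f) → coker g`
  let θ : (X ⧸ (g ∘ₗ f).range) →ₗ[ℂ] X ⧸ g.range :=
    (g ∘ₗ f).range.mapQ g.range LinearMap.id (LinearMap.range_comp_le_range f g)
  have hθs : θ.range = ⊤ := by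
    rw [Submodule.range_mapQ, LinearMap.range_id, Submodule.map_top, Submodule.range_mkQ]
  have hθ : θ.ker = χ.range := by
    ext y
    obtain ⟨x, rfl⟩ := Submodule.mkQ_surjective _ y
    simp only [θ, χ, LinearMap.mem_ker, Submodule.mkQ_apply, Submodule.mapQ_apply,
      LinearMap.id_apply, Submodule.Quotient.mk_eq_zero, LinearMap.mem_range]
    constructor
    · rintro ⟨w, rfl⟩
      exact ⟨f.range.mkQ w, rfl⟩
    · rintro ⟨z, hz⟩
      obtain ⟨w, rfl⟩ := Submodule.mkQ_surjective _ z
      obtain ⟨v, hv⟩ := (Submodule.Quotient.eq _).mp hz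
      refine ⟨w - f v, ?_⟩
      rw [map_sub, ← LinearMap.comp_apply g f v, hv]
      simp
  have hc : FiniteDimensional ℂ (X ⧸ (g ∘ₗ f).range) := by
    have : FiniteDimensional ℂ θ.ker := by rw [hθ]; infer_instance
    exact finiteDimensional_of_ker_range θ
  have e4 := θ.finrank_range_add_finrank_ker
  rw [hθ, hθs, finrank_top] at e4
  refine ⟨⟨hk, hc⟩, ?_⟩
  simp only [linearIndex]
  omega

/-- An operator of the form `1 + f` with `f` of finite rank has index zero. -/
theorem linearIndex_one_add {f : V →ₗ[ℂ] V} (hf : FiniteDimensional ℂ f.range) :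
    HasIndex (LinearMap.id + f) ∧ linearIndex (LinearMap.id + f) = 0 := by
  set g := LinearMap.id + f with hg
  -- `g` is the identity modulo the range of `f`, so it has the kernel and cokernel of its
  -- restriction `r`, an endomorphism of a finite dimensional space.
  let r : f.range →ₗ[ℂ] f.range := g.restrict fun x hx => by
    simpa [hg] using add_mem hx ⟨x, rfl⟩
  let ι : g.ker ≃ₗ[ℂ] r.ker :=
    { toFun := fun x => ⟨⟨x.1, ⟨-x.1, by
          have := LinearMap.mem_ker.mp x.2
          simp only [hg, LinearMap.add_apply, LinearMap.id_apply] at this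
          rw [map_neg]
          exact (eq_neg_of_add_eq_zero_left this).symm⟩⟩,
        LinearMap.mem_ker.mpr (Subtype.ext (LinearMap.mem_ker.mp x.2))⟩
      map_add' := fun _ _ => rfl
      map_smul' := fun _ _ => rfl
      invFun := fun x => ⟨x.1.1, congrArg Subtype.val (LinearMap.mem_ker.mp x.2)⟩
      left_inv := fun _ => rfl
      right_inv := fun _ => rfl }
  let q : f.range →ₗ[ℂ] V ⧸ g.range := g.range.mkQ ∘ₗ f.range.subtype
  have hqs : Function.Surjective q := by
    intro y
    obtain ⟨v, rfl⟩ := Submodule.mkQ_surjective _ y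
    refine ⟨⟨-f v, -v, by simp⟩, ?_⟩
    simp only [q, LinearMap.comp_apply, Submodule.subtype_apply, Submodule.mkQ_apply]
    rw [Submodule.Quotient.eq]
    exact ⟨-v, by simp [hg]; abel⟩
  have hqk : q.ker = r.range := by
    ext ⟨y, hy⟩
    simp only [q, LinearMap.mem_ker, LinearMap.comp_apply, Submodule.subtype_apply,
      Submodule.mkQ_apply, Submodule.Quotient.mk_eq_zero, LinearMap.mem_range]
    constructor
    · rintro ⟨x, hx⟩
      have hxr : x ∈ f.range := by
        have : x = y - f x := by rw [← hx]; simp [hg]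
        rw [this]
        exact sub_mem hy ⟨x, rfl⟩
      exact ⟨⟨x, hxr⟩, Subtype.ext hx⟩
    · rintro ⟨x, hx⟩
      exact ⟨x, congrArg Subtype.val hx⟩
  have hc : FiniteDimensional ℂ (V ⧸ g.range) := Module.Finite.of_surjective q hqs
  refine ⟨⟨ι.symm.finiteDimensional, hc⟩, ?_⟩
  have e1 := r.finrank_range_add_finrank_ker
  have e2 := q.finrank_range_add_finrank_ker
  rw [hqk, LinearMap.range_eq_top.mpr hqs, finrank_top] at e2
  rw [linearIndex, ι.finrank_eq]
  omega

end LinearIndex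

/-! ### Compact perturbations and the index -/

section CompactPerturbation

universe u

variable {E F : Type u} [NormedAddCommGroup E] [InnerProductSpace ℂ E] [CompleteSpace E]
  [NormedAddCommGroup F] [InnerProductSpace ℂ F] [CompleteSpace F]

theorem isUnit_id_add_of_norm_lt_one {G : E →L[ℂ] E} (hG : ‖G‖ < 1) : IsUnit (1 + G) := by
  have := isUnit_one_sub_of_norm_lt_one (x := -G) (by rwa [norm_neg])
  rwa [sub_neg_eq_add] at this

/-- Choose `S` of finite rank with `‖C - S‖ < 1`. Then `u = 1 + (C - S)` is invertible and `1 + C =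
u (1 + u⁻¹ S)`, which reduces the claim to finite rank. -/
theorem linearIndex_id_add_of_isCompactOperator {C : E →L[ℂ] E} (hC : IsCompactOperator C) :
    HasIndex (LinearMap.id + (C : E →ₗ[ℂ] E)) ∧ linearIndex (LinearMap.id + (C : E →ₗ[ℂ] E)) = 0 := by
  obtain ⟨S, hS, hCS⟩ := exists_finiteDimensional_range_norm_sub_lt hC one_pos
  obtain ⟨u, hu⟩ := isUnit_id_add_of_norm_lt_one hCS
  have hbij : Function.Bijective ((u : E →L[ℂ] E) : E →ₗ[ℂ] E) :=
    ContinuousLinearMap.isUnit_iff_bijective.mp u.isUnit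
  have hfin : FiniteDimensional ℂ
      (((↑u⁻¹ : E →L[ℂ] E) : E →ₗ[ℂ] E) ∘ₗ (S : E →ₗ[ℂ] E)).range := by
    rw [LinearMap.range_comp]
    infer_instance
  have heq : LinearMap.id + (C : E →ₗ[ℂ] E) = ((u : E →L[ℂ] E) : E →ₗ[ℂ] E) ∘ₗ
      (LinearMap.id + ((↑u⁻¹ : E →L[ℂ] E) : E →ₗ[ℂ] E) ∘ₗ (S : E →ₗ[ℂ] E)) := by
    ext x
    have h1 : (u : E →L[ℂ] E) ((↑u⁻¹ : E →L[ℂ] E) (S x)) = S x := by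
      rw [← mul_apply_eq_comp, Units.mul_inv, one_apply_eq_self]
    have h2 : (u : E →L[ℂ] E) x = x + (C x - S x) := by rw [hu]; simp
    simp only [LinearMap.add_apply, LinearMap.id_apply, LinearMap.comp_apply,
      ContinuousLinearMap.coe_coe, map_add, h1, h2]
    abel
  obtain ⟨h1, h2⟩ := linearIndex_one_add hfin
  obtain ⟨h3, h4⟩ := linearIndex_comp h1 (HasIndex.of_bijective hbij)
  rw [heq]
  exact ⟨h3, by rw [h4, h2, linearIndex_of_bijective hbij, add_zero]⟩

/-- Operators that are inverse to each other modulo compact operators have opposite indices. -/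
theorem linearIndex_add_eq_zero {T : E →L[ℂ] F} {S : F →L[ℂ] E}
    (h1 : IsCompactOperator (S ∘L T - ContinuousLinearMap.id ℂ E))
    (h2 : IsCompactOperator (T ∘L S - ContinuousLinearMap.id ℂ F)) :
    HasIndex (T : E →ₗ[ℂ] F) ∧ HasIndex (S : F →ₗ[ℂ] E) ∧
      linearIndex (T : E →ₗ[ℂ] F) + linearIndex (S : F →ₗ[ℂ] E) = 0 := by
  obtain ⟨a1, b1⟩ := linearIndex_id_add_of_isCompactOperator h1
  obtain ⟨a2, -⟩ := linearIndex_id_add_of_isCompactOperator h2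
  have e1 : LinearMap.id + ((S ∘L T - ContinuousLinearMap.id ℂ E : E →L[ℂ] E) : E →ₗ[ℂ] E) =
      (S : F →ₗ[ℂ] E) ∘ₗ (T : E →ₗ[ℂ] F) := by ext x; simp
  have e2 : LinearMap.id + ((T ∘L S - ContinuousLinearMap.id ℂ F : F →L[ℂ] F) : F →ₗ[ℂ] F) =
      (T : E →ₗ[ℂ] F) ∘ₗ (S : F →ₗ[ℂ] E) := by ext x; simp
  rw [e1] at a1 b1
  rw [e2] at a2
  -- The kernel of `f` lies in that of `g ∘ f`, and the cokernel of `f` is a quotient of that of `f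
  -- ∘ g`.
  have key : ∀ {V W : Type u} [AddCommGroup V] [Module ℂ V] [AddCommGroup W] [Module ℂ W]
      (f : V →ₗ[ℂ] W) (g : W →ₗ[ℂ] V), HasIndex (g ∘ₗ f) → HasIndex (f ∘ₗ g) → HasIndex f := by
    intro V W _ _ _ _ f g h h'
    have := h.finite_ker
    have := h'.finite_coker
    exact ⟨Submodule.finiteDimensional_of_le (LinearMap.ker_le_ker_comp f g),
      Module.Finite.of_surjective _ (Submodule.factor_surjective (LinearMap.range_comp_le_range g f))⟩
  have hT := key _ _ a1 a2
  have hS := key _ _ a2 a1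
  obtain ⟨-, h⟩ := linearIndex_comp hT hS
  exact ⟨hT, hS, by rw [add_comm, ← h, b1]⟩

/-- The operator `S` inverts both `T` and `T'` modulo compacts, so both indices are the negative of
the index of `S`. -/
theorem linearIndex_eq_of_isCompactOperator_sub {T T' : E →L[ℂ] F} {S : F →L[ℂ] E}
    (h1 : IsCompactOperator (S ∘L T - ContinuousLinearMap.id ℂ E))
    (h2 : IsCompactOperator (T ∘L S - ContinuousLinearMap.id ℂ F))
    (h : IsCompactOperator (T' - T)) :
    linearIndex (T' : E →ₗ[ℂ] F) = linearIndex (T : E →ₗ[ℂ] F) := by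
  have h1' : IsCompactOperator (S ∘L T' - ContinuousLinearMap.id ℂ E) := by
    have e : S ∘L T' - ContinuousLinearMap.id ℂ E =
        S ∘L (T' - T) + (S ∘L T - ContinuousLinearMap.id ℂ E) := by ext x; simp
    rw [e]
    exact (h.clm_comp S).add h1
  have h2' : IsCompactOperator (T' ∘L S - ContinuousLinearMap.id ℂ F) := by
    have e : T' ∘L S - ContinuousLinearMap.id ℂ F =
        (T' - T) ∘L S + (T ∘L S - ContinuousLinearMap.id ℂ F) := by ext x; simp
    rw [e]
    exact (h.comp_clm S).add h2
  have e1 := (linearIndex_add_eq_zero h1 h2).2.2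
  have e2 := (linearIndex_add_eq_zero h1' h2').2.2
  omega

end CompactPerturbation

/-! ### The index of a pair of closed subspaces -/

section Pairs

universe u

variable {H : Type u} [NormedAddCommGroup H] [InnerProductSpace ℂ H]

/-- The restriction to `M` of the orthogonal projection onto `L`. -/
noncomputable def relProj (M L : Submodule ℂ H) [CompleteSpace L] : M →L[ℂ] L :=
  L.orthogonalProjectionOnto ∘L M.subtypeL

/-- The index `dim (M ∩ Lᗮ) - dim (L ∩ Mᗮ)` of a pair of subspaces. -/
noncomputable def pairIndex (M L : Submodule ℂ H) : ℤ :=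
  (Module.finrank ℂ (M ⊓ Lᗮ : Submodule ℂ H) : ℤ) - Module.finrank ℂ (L ⊓ Mᗮ : Submodule ℂ H)

variable (M L N : Submodule ℂ H) [CompleteSpace M] [CompleteSpace L] [CompleteSpace N]

/-- The defect of composition is a compression of a difference of projections, so it lies in every
operator ideal containing that difference. With `N = M` it makes `M → L` and `L → M` mutually
inverse modulo the ideal. -/
theorem relProj_comp_sub :
    relProj L N ∘L relProj M L - relProj M N =
      N.orthogonalProjectionOnto ∘L (L.starProjection - M.starProjection) ∘L M.subtypeL := by
  ext x
  simp [relProj]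

theorem relProj_self : relProj M M = ContinuousLinearMap.id ℂ M := by
  ext x
  simp [relProj]

variable {M L N}

theorem isCompactOperator_relProj_comp_sub
    (h : IsCompactOperator (M.starProjection - L.starProjection)) :
    IsCompactOperator (relProj L N ∘L relProj M L - relProj M N) := by
  rw [relProj_comp_sub]
  have h' : IsCompactOperator (L.starProjection - M.starProjection) := by
    rw [← neg_sub]
    exact h.neg
  have h'' : IsCompactOperator ((L.starProjection - M.starProjection) ∘L M.subtypeL) :=
    h'.comp_clm M.subtypeL
  exact h''.clm_comp N.orthogonalProjectionOnto

theorem isCompactOperator_relProj_comp_sub_id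
    (h : IsCompactOperator (M.starProjection - L.starProjection)) :
    IsCompactOperator (relProj L M ∘L relProj M L - ContinuousLinearMap.id ℂ M) := by
  rw [← relProj_self]
  exact isCompactOperator_relProj_comp_sub h

theorem isCompactOperator_starProjection_sub_symm
    (h : IsCompactOperator (M.starProjection - L.starProjection)) :
    IsCompactOperator (L.starProjection - M.starProjection) := by
  rw [← neg_sub]
  exact h.neg

theorem relProj_hasIndex (h : IsCompactOperator (M.starProjection - L.starProjection)) :
    HasIndex (relProj M L : M →ₗ[ℂ] L) :=
  (linearIndex_add_eq_zero (T := relProj M L) (S := relProj L M) (isCompactOperator_relProj_comp_sub_id h)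
    (isCompactOperator_relProj_comp_sub_id (isCompactOperator_starProjection_sub_symm h))).1

omit [CompleteSpace M] in
theorem relProj_apply (x : M) : relProj M L x = L.orthogonalProjectionOnto (x : H) := rfl

omit [CompleteSpace M] in
theorem map_subtype_ker_relProj :
    (relProj M L : M →ₗ[ℂ] L).ker.map M.subtype = M ⊓ Lᗮ := by
  ext x
  simp only [Submodule.mem_map, LinearMap.mem_ker, Submodule.mem_inf, Submodule.subtype_apply,
    ContinuousLinearMap.coe_coe, relProj_apply, Submodule.orthogonalProjectionOnto_eq_zero_iff]
  constructor
  · rintro ⟨y, hy, rfl⟩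
    exact ⟨y.2, hy⟩
  · rintro ⟨hx, hx'⟩
    exact ⟨⟨x, hx⟩, hx', rfl⟩

omit [CompleteSpace M] in
theorem finrank_ker_relProj : Module.finrank ℂ (relProj M L : M →ₗ[ℂ] L).ker =
    Module.finrank ℂ (M ⊓ Lᗮ : Submodule ℂ H) := by
  rw [← map_subtype_ker_relProj (M := M) (L := L)]
  exact (Submodule.equivSubtypeMap M (relProj M L : M →ₗ[ℂ] L).ker).finrank_eq

theorem finiteDimensional_inf_orthogonal
    (h : IsCompactOperator (M.starProjection - L.starProjection)) :
    FiniteDimensional ℂ (M ⊓ Lᗮ : Submodule ℂ H) := by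
  have := (relProj_hasIndex h).finite_ker
  rw [← map_subtype_ker_relProj (M := M) (L := L)]
  infer_instance

/-- The kernel of `L → M` is `L ∩ Mᗮ`, which is orthogonal to the range of `M → L` and so embeds in
the cokernel. The inequality needs no closedness of the range. -/
theorem finrank_ker_relProj_le (h : FiniteDimensional ℂ (L ⧸ (relProj M L : M →ₗ[ℂ] L).range)) :
    Module.finrank ℂ (relProj L M : L →ₗ[ℂ] M).ker ≤
      Module.finrank ℂ (L ⧸ (relProj M L : M →ₗ[ℂ] L).range) := by
  refine LinearMap.finrank_le_finrank_of_injective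
    (f := (relProj M L : M →ₗ[ℂ] L).range.mkQ ∘ₗ (relProj L M : L →ₗ[ℂ] M).ker.subtype) ?_
  rw [← LinearMap.ker_eq_bot, LinearMap.ker_eq_bot']
  rintro ⟨y, hy⟩ hy0
  have hyM : (y : H) ∈ Mᗮ :=
    Submodule.orthogonalProjectionOnto_eq_zero_iff.mp (LinearMap.mem_ker.mp hy)
  obtain ⟨x, hx⟩ : y ∈ (relProj M L : M →ₗ[ℂ] L).range :=
    (Submodule.Quotient.mk_eq_zero _).mp hy0
  have h0 : ⟪(y : H), (y : H)⟫_ℂ = 0 := by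
    have h1 : (y : H) = L.starProjection x := by rw [← hx]; rfl
    have h2 : ⟪(y : H), L.starProjection (x : H)⟫_ℂ = ⟪(y : H), (x : H)⟫_ℂ := by
      rw [← Submodule.inner_starProjection_left_eq_right, Submodule.starProjection_eq_self_iff.mpr y.2]
    conv_lhs => rw [h1, ← h1]
    rw [show ⟪(y : H), (y : H)⟫_ℂ = ⟪(y : H), L.starProjection (x : H)⟫_ℂ by rw [← h1], h2]
    exact (Submodule.mem_orthogonal' _ _).mp hyM x x.2
  exact Subtype.ext (Subtype.ext (inner_self_eq_zero.mp h0))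

/-- The index of the projection `M → L` is the index of the pair `(M, L)`. -/
theorem linearIndex_relProj (h : IsCompactOperator (M.starProjection - L.starProjection)) :
    linearIndex (relProj M L : M →ₗ[ℂ] L) = pairIndex M L := by
  have h' := isCompactOperator_starProjection_sub_symm h
  -- The indices of `M → L` and `L → M` cancel, which forces equality in both `l1` and `l2`.
  have e := (linearIndex_add_eq_zero (T := relProj M L) (S := relProj L M) (isCompactOperator_relProj_comp_sub_id h)
    (isCompactOperator_relProj_comp_sub_id h')).2.2
  have l1 := finrank_ker_relProj_le (M := M) (L := L) (relProj_hasIndex h).finite_coker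
  have l2 := finrank_ker_relProj_le (M := L) (L := M) (relProj_hasIndex h').finite_coker
  rw [pairIndex, ← finrank_ker_relProj (M := M) (L := L), ← finrank_ker_relProj (M := L) (L := M)]
  simp only [linearIndex] at e ⊢
  omega

/-- The composition `M → L → N` is a compact perturbation of `M → N`, and the index of a composition
is the sum. -/
theorem pairIndex_add (h₁ : IsCompactOperator (M.starProjection - L.starProjection))
    (h₂ : IsCompactOperator (L.starProjection - N.starProjection)) :
    pairIndex M N = pairIndex M L + pairIndex L N := by
  have h₃ : IsCompactOperator (M.starProjection - N.starProjection) := by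
    rw [← sub_add_sub_cancel M.starProjection L.starProjection N.starProjection]
    exact h₁.add h₂
  have e1 := (linearIndex_comp (relProj_hasIndex h₁) (relProj_hasIndex h₂)).2
  have e2 := linearIndex_eq_of_isCompactOperator_sub (T := relProj M N) (S := relProj N M)
    (T' := relProj L N ∘L relProj M L) (isCompactOperator_relProj_comp_sub_id h₃)
    (isCompactOperator_relProj_comp_sub_id (isCompactOperator_starProjection_sub_symm h₃))
    (isCompactOperator_relProj_comp_sub (N := N) h₁)
  rw [← linearIndex_relProj h₁, ← linearIndex_relProj h₂, ← linearIndex_relProj h₃, add_comm,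
    ← e1, ← e2]
  rfl

omit [CompleteSpace M] [CompleteSpace L] in
theorem pairIndex_swap : pairIndex M L = -pairIndex L M := by
  simp [pairIndex]

/-- A vector of `M ∩ Lᗮ` is fixed by the difference of the projections, hence zero; likewise for `L
∩ Mᗮ`. -/
theorem pairIndex_eq_zero_of_norm_sub_lt_one
    (h : ‖M.starProjection - L.starProjection‖ < 1) : pairIndex M L = 0 := by
  have key : ∀ {M L : Submodule ℂ H} [CompleteSpace M] [CompleteSpace L],
      ‖M.starProjection - L.starProjection‖ < 1 → M ⊓ Lᗮ = ⊥ := by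
    intro M L _ _ h
    refine (Submodule.eq_bot_iff _).mpr fun x hx => ?_
    have hx1 : (M.starProjection - L.starProjection) x = x := by
      rw [sub_apply, Submodule.starProjection_eq_self_iff.mpr hx.1,
        (Submodule.starProjection_apply_eq_zero_iff L).mpr hx.2, sub_zero]
    by_contra hx0
    have h1 := (M.starProjection - L.starProjection).le_opNorm x
    rw [hx1] at h1
    have : 0 < ‖x‖ := norm_pos_iff.mpr hx0
    nlinarith
  rw [pairIndex, key h, key (by rwa [norm_sub_rev])]
  simp

end Pairs

/-! ### Intertwining two projections of index zero -/

section Algebra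

variable {R : Type*} [Ring R] [StarRing R]

/-- The model is `E₁`, `E₂` the projections onto `M ∩ Lᗮ`, `L ∩ Mᗮ`, and `j` a partial isometry
between them. The element `1 - P - Q + 2QP` is `B = QP + (1 - Q)(1 - P)`, and `B*B = 1 - (P - Q)²`.
The term `j - j*` repairs the kernel of `B`; being skew-adjoint, it does not disturb `B + B* = 2
B*B`. -/
theorem star_mul_self_intertwiner {P Q E₁ E₂ j : R} (hP : P * P = P) (hQ : Q * Q = Q)
    (hPs : star P = P) (hQs : star Q = Q) (hPE₁ : P * E₁ = E₁) (hPE₂ : P * E₂ = 0)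
    (hQE₁ : Q * E₁ = 0) (hQE₂ : Q * E₂ = E₂) (hE₁ : star E₁ = E₁) (hE₂ : star E₂ = E₂)
    (hj₁ : star j * j = E₁) (hj₂ : j * star j = E₂) (hjE : j * E₁ = j) (hEj : E₂ * j = j) :
    (1 - P - Q + 2 * (Q * P) + (j - star j)) * P = Q * (1 - P - Q + 2 * (Q * P) + (j - star j)) ∧
    star (1 - P - Q + 2 * (Q * P) + (j - star j)) * (1 - P - Q + 2 * (Q * P) + (j - star j)) =
      star (1 - P - Q + 2 * (Q * P)) * (1 - P - Q + 2 * (Q * P)) + E₁ + E₂ ∧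
    (1 - P - Q + 2 * (Q * P) + (j - star j)) * star (1 - P - Q + 2 * (Q * P) + (j - star j)) =
      star (1 - P - Q + 2 * (Q * P)) * (1 - P - Q + 2 * (Q * P)) + E₁ + E₂ ∧
    (1 - P - Q + 2 * (Q * P) + (j - star j)) + star (1 - P - Q + 2 * (Q * P) + (j - star j)) =
      2 * (star (1 - P - Q + 2 * (Q * P)) * (1 - P - Q + 2 * (Q * P))) ∧
    Commute (star (1 - P - Q + 2 * (Q * P)) * (1 - P - Q + 2 * (Q * P)) + E₁ + E₂) P ∧
    star (1 - P - Q + 2 * (Q * P)) * (1 - P - Q + 2 * (Q * P)) = 1 - P - Q + P * Q + Q * P := by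
  have hE₁P : E₁ * P = E₁ := by simpa [hPs, hE₁] using congrArg star hPE₁
  have hE₂P : E₂ * P = 0 := by simpa [hPs, hE₂] using congrArg star hPE₂
  have hE₁Q : E₁ * Q = 0 := by simpa [hQs, hE₁] using congrArg star hQE₁
  have hjP : j * P = j := by rw [← hjE, mul_assoc, hE₁P]
  have hPj : P * j = 0 := by rw [← hEj, ← mul_assoc, hPE₂, zero_mul]
  have hQj : Q * j = j := by rw [← hEj, ← mul_assoc, hQE₂]
  have hjQ : j * Q = 0 := by rw [← hjE, mul_assoc, hE₁Q, mul_zero]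
  have hjj : j * j = 0 := by
    calc j * j = j * P * j := by rw [hjP]
      _ = 0 := by rw [mul_assoc, hPj, mul_zero]
  have hPj' : P * star j = star j := by simpa [hPs] using congrArg star hjP
  have hjP' : star j * P = 0 := by simpa [hPs] using congrArg star hPj
  have hjQ' : star j * Q = star j := by simpa [hQs] using congrArg star hQj
  have hQj' : Q * star j = 0 := by simpa [hQs] using congrArg star hjQ
  have hjj' : star j * star j = 0 := by simpa using congrArg star hjj
  have hPP (x : R) : P * (P * x) = P * x := by rw [← mul_assoc, hP]
  have hQQ (x : R) : Q * (Q * x) = Q * x := by rw [← mul_assoc, hQ]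
  have h2 : (2 : R) = 1 + 1 := one_add_one_eq_two.symm
  have hstar : star (1 - P - Q + 2 * (Q * P)) = 1 - P - Q + 2 * (P * Q) := by
    simp [h2, hPs, hQs, add_mul]
  have hstar' : star (1 - P - Q + 2 * (Q * P) + (j - star j)) =
      1 - P - Q + 2 * (P * Q) + (star j - j) := by
    rw [star_add, hstar, star_sub, star_star]
  have hB : star (1 - P - Q + 2 * (Q * P)) * (1 - P - Q + 2 * (Q * P)) =
      1 - P - Q + P * Q + Q * P := by
    rw [hstar]
    simp only [h2, mul_add, add_mul, mul_sub, sub_mul, one_mul, mul_one, mul_assoc, hP, hQ, hQQ]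
    abel
  rw [hB, hstar']
  refine ⟨?_, ?_, ?_, ?_, ?_, rfl⟩
  · simp only [h2, mul_add, add_mul, mul_sub, sub_mul, one_mul, mul_one, mul_assoc, hP, hQ, hQQ,
      hjP, hQj, hjP', hQj']
    abel
  · simp only [h2, mul_add, add_mul, mul_sub, sub_mul, one_mul, mul_one, mul_assoc, hP, hQ, hQQ,
      hjP, hPj, hjQ, hjj, hPj', hjQ', hjj', hQj, hjP', hQj', hj₁, hj₂, mul_zero]
    simp only [← mul_assoc, hjQ', hjP', hjQ, zero_mul]
    abel
  · simp only [h2, mul_add, add_mul, mul_sub, sub_mul, one_mul, mul_one, mul_assoc, hP, hQ, hPP,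
      hjP, hPj, hjQ, hjj, hPj', hjQ', hjj', hQj, hjP', hQj', hj₁, hj₂, mul_zero]
    simp only [← mul_assoc, hjP', hjQ, hjP, zero_mul]
    abel
  · simp only [h2, mul_add, add_mul, mul_sub, one_mul, mul_one]
    abel
  · rw [Commute, SemiconjBy]
    simp only [mul_add, add_mul, mul_sub, sub_mul, one_mul, mul_one, mul_assoc, hP, hPP,
      hE₁P, hE₂P, hPE₁, hPE₂]
    abel

end Algebra

section Intertwiner

universe u

variable {H : Type u} [NormedAddCommGroup H] [InnerProductSpace ℂ H] [CompleteSpace H]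

/-- Two subspaces of the same finite dimension are related by a partial isometry. -/
theorem exists_partialIsometry (N₁ N₂ : Submodule ℂ H) [FiniteDimensional ℂ N₁]
    [FiniteDimensional ℂ N₂] (h : Module.finrank ℂ N₁ = Module.finrank ℂ N₂) :
    ∃ j : H →L[ℂ] H, star j * j = N₁.starProjection ∧ j * star j = N₂.starProjection ∧
      j * N₁.starProjection = j ∧ N₂.starProjection * j = j := by
  let J : N₁ ≃ₗᵢ[ℂ] N₂ := (stdOrthonormalBasis ℂ N₁).repr.trans
    ((stdOrthonormalBasis ℂ N₂).reindex (finCongr h.symm)).repr.symm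
  let j : H →L[ℂ] H := N₂.subtypeL ∘L (J : N₁ →L[ℂ] N₂) ∘L N₁.orthogonalProjectionOnto
  let k : H →L[ℂ] H := N₁.subtypeL ∘L (J.symm : N₂ →L[ℂ] N₁) ∘L N₂.orthogonalProjectionOnto
  have hjk : star j = k := by
    refine ((ContinuousLinearMap.eq_adjoint_iff k j).mpr fun x y => ?_).symm
    calc ⟪k x, y⟫_ℂ = ⟪J.symm (N₂.orthogonalProjectionOnto x), N₁.orthogonalProjectionOnto y⟫_ℂ :=
          (Submodule.inner_orthogonalProjectionOnto_eq_of_mem_left _ _).symm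
      _ = ⟪N₂.orthogonalProjectionOnto x, J (N₁.orthogonalProjectionOnto y)⟫_ℂ := by
          rw [← J.inner_map_map, J.apply_symm_apply]
      _ = ⟪x, j y⟫_ℂ := Submodule.inner_orthogonalProjectionOnto_eq_of_mem_right _ _
  refine ⟨j, ?_, ?_, ?_, ?_⟩
  · rw [hjk]
    ext x
    simp [j, k]
  · rw [hjk]
    ext x
    simp [j, k]
  · ext x
    have : N₁.orthogonalProjectionOnto (N₁.starProjection x) = N₁.orthogonalProjectionOnto x :=
      N₁.orthogonalProjectionOnto_mem_subspace_eq_self (N₁.orthogonalProjectionOnto x)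
    simp [j, this]
  · ext x
    simp [j]

/-- Index zero says that `M ∩ Lᗮ` and `L ∩ Mᗮ`, both finite dimensional, have equal dimension, which
provides `j` and `X = B + j - j*`. The last clause places `X - 1` in the ideal of `P - Q`, up to
finite rank. -/
theorem exists_intertwiner {M L : Submodule ℂ H} [CompleteSpace M] [CompleteSpace L]
    (h : IsCompactOperator (M.starProjection - L.starProjection)) (hind : pairIndex M L = 0) :
    ∃ X B : H →L[ℂ] H, X * M.starProjection = L.starProjection * X ∧
      star X * X = X * star X ∧ Commute (star X * X) M.starProjection ∧
      X + star X = 2 * (star B * B) ∧ Commute (star B * B) M.starProjection ∧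
      Function.Injective X ∧
      FiniteDimensional ℂ ((X - 1 - (L.starProjection * (M.starProjection - L.starProjection) -
        (M.starProjection - L.starProjection) * M.starProjection) : H →L[ℂ] H) : H →ₗ[ℂ] H).range := by
  have h' := isCompactOperator_starProjection_sub_symm h
  have hf₁ := finiteDimensional_inf_orthogonal h
  have hf₂ := finiteDimensional_inf_orthogonal h'
  set P := M.starProjection with hPdef
  set Q := L.starProjection with hQdef
  have hfr : Module.finrank ℂ (M ⊓ Lᗮ : Submodule ℂ H) =
      Module.finrank ℂ (L ⊓ Mᗮ : Submodule ℂ H) := by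
    rw [pairIndex] at hind
    omega
  obtain ⟨j, hj₁, hj₂, hjE, hEj⟩ := exists_partialIsometry _ _ hfr
  set E₁ := (M ⊓ Lᗮ : Submodule ℂ H).starProjection with hE₁def
  set E₂ := (L ⊓ Mᗮ : Submodule ℂ H).starProjection with hE₂def
  have hPp : IsStarProjection P := isStarProjection_starProjection
  have hQp : IsStarProjection Q := isStarProjection_starProjection
  have hE₁p : IsStarProjection E₁ := isStarProjection_starProjection
  have hE₂p : IsStarProjection E₂ := isStarProjection_starProjection
  have m₁ : ∀ x, E₁ x ∈ M ⊓ Lᗮ := Submodule.starProjection_apply_mem _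
  have m₂ : ∀ x, E₂ x ∈ L ⊓ Mᗮ := Submodule.starProjection_apply_mem _
  have hPE₁ : P * E₁ = E₁ := by
    ext x; exact Submodule.starProjection_eq_self_iff.mpr (m₁ x).1
  have hQE₁ : Q * E₁ = 0 := by
    ext x; exact (Submodule.starProjection_apply_eq_zero_iff L).mpr (m₁ x).2
  have hPE₂ : P * E₂ = 0 := by
    ext x; exact (Submodule.starProjection_apply_eq_zero_iff M).mpr (m₂ x).2
  have hQE₂ : Q * E₂ = E₂ := by
    ext x; exact Submodule.starProjection_eq_self_iff.mpr (m₂ x).1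
  obtain ⟨a1, a2, a3, a4, a5, a6⟩ := star_mul_self_intertwiner hPp.isIdempotentElem.eq
    hQp.isIdempotentElem.eq hPp.isSelfAdjoint.star_eq hQp.isSelfAdjoint.star_eq hPE₁ hPE₂ hQE₁ hQE₂
    hE₁p.isSelfAdjoint.star_eq hE₂p.isSelfAdjoint.star_eq hj₁ hj₂ hjE hEj
  set B := 1 - P - Q + 2 * (Q * P) with hB
  have a7 : Commute (star B * B) P := by
    rw [a6, Commute, SemiconjBy]
    simp only [mul_add, add_mul, mul_sub, sub_mul, one_mul, mul_one, mul_assoc,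
      hPp.isIdempotentElem.eq]
    simp only [← mul_assoc, hPp.isIdempotentElem.eq]
    abel
  refine ⟨B + (j - star j), B, a1, a2.trans a3.symm, a2 ▸ a5, a4, a7, ?_, ?_⟩
  · refine (injective_iff_map_eq_zero (B + (j - star j))).mpr fun v hv' => ?_
    have hZ : (star B * B + E₁ + E₂) v = 0 := by
      rw [← a2, mul_apply_eq_comp, hv', map_zero]
    have hstar : ∀ (A : H →L[ℂ] H), ⟪v, (star A * A) v⟫_ℂ = ((‖A v‖ ^ 2 : ℝ) : ℂ) := fun A => by
      rw [mul_apply_eq_comp, ContinuousLinearMap.star_eq_adjoint,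
        ContinuousLinearMap.adjoint_inner_right, inner_self_eq_norm_sq_to_K]
      simp
    have hE₁' : E₁ = star E₁ * E₁ := by
      rw [hE₁p.isSelfAdjoint.star_eq, hE₁p.isIdempotentElem.eq]
    have hE₂' : E₂ = star E₂ * E₂ := by
      rw [hE₂p.isSelfAdjoint.star_eq, hE₂p.isIdempotentElem.eq]
    have hsum : ‖B v‖ ^ 2 + ‖E₁ v‖ ^ 2 + ‖E₂ v‖ ^ 2 = 0 := by
      have : ⟪v, (star B * B + E₁ + E₂) v⟫_ℂ = 0 := by rw [hZ, inner_zero_right]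
      rw [hE₁', hE₂', add_apply, add_apply, inner_add_right, inner_add_right, hstar, hstar,
        hstar] at this
      exact_mod_cast this
    have hBv : B v = 0 := by
      rw [← norm_eq_zero]
      nlinarith [sq_nonneg ‖B v‖, sq_nonneg ‖E₁ v‖, sq_nonneg ‖E₂ v‖]
    have hE₁v : E₁ v = 0 := by
      rw [← norm_eq_zero]
      nlinarith [sq_nonneg ‖B v‖, sq_nonneg ‖E₁ v‖, sq_nonneg ‖E₂ v‖]
    have hE₂v : E₂ v = 0 := by
      rw [← norm_eq_zero]
      nlinarith [sq_nonneg ‖B v‖, sq_nonneg ‖E₁ v‖, sq_nonneg ‖E₂ v‖]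
    have hBB : v - P v - Q v + P (Q v) + Q (P v) = 0 := by
      have : (star B * B) v = 0 := by rw [mul_apply_eq_comp, hBv, map_zero]
      rw [a6] at this
      simpa using this
    have hPP : ∀ x, P (P x) = P x := fun x => by
      rw [← mul_apply_eq_comp, hPp.isIdempotentElem.eq]
    have hQQ : ∀ x, Q (Q x) = Q x := fun x => by
      rw [← mul_apply_eq_comp, hQp.isIdempotentElem.eq]
    -- Applying `P` to `B*B v = 0` leaves `PQP v = 0`, hence `QP v = 0`. So `P v` lies in `M ∩ Lᗮ`,
    -- where `E₁` is the identity, while `E₁ v = 0`; the argument for `Q v` is symmetric.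
    have hPQP : P (Q (P v)) = 0 := by
      have := congrArg P hBB
      simp only [map_add, map_sub, hPP, map_zero] at this
      rw [← this]; abel
    have hQPQ : Q (P (Q v)) = 0 := by
      have := congrArg Q hBB
      simp only [map_add, map_sub, hQQ, map_zero] at this
      rw [← this]; abel
    have hQP : Q (P v) = 0 := by
      rw [← inner_self_eq_zero (𝕜 := ℂ)]
      calc ⟪Q (P v), Q (P v)⟫_ℂ = ⟪P v, Q (Q (P v))⟫_ℂ :=
            hQp.isSelfAdjoint.isSymmetric (P v) (Q (P v))
        _ = ⟪v, P (Q (P v))⟫_ℂ := by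
            rw [hQQ]; exact hPp.isSelfAdjoint.isSymmetric v (Q (P v))
        _ = 0 := by rw [hPQP, inner_zero_right]
    have hPQ : P (Q v) = 0 := by
      rw [← inner_self_eq_zero (𝕜 := ℂ)]
      calc ⟪P (Q v), P (Q v)⟫_ℂ = ⟪Q v, P (P (Q v))⟫_ℂ :=
            hPp.isSelfAdjoint.isSymmetric (Q v) (P (Q v))
        _ = ⟪v, Q (P (Q v))⟫_ℂ := by
            rw [hPP]; exact hQp.isSelfAdjoint.isSymmetric v (P (Q v))
        _ = 0 := by rw [hQPQ, inner_zero_right]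
    have hPv : P v = 0 := by
      have h1 : E₁ (P v) = P v := Submodule.starProjection_eq_self_iff.mpr
        ⟨M.starProjection_apply_mem v, (Submodule.starProjection_apply_eq_zero_iff L).mp hQP⟩
      have h2 : E₁ * P = E₁ := by
        simpa [hPp.isSelfAdjoint.star_eq, hE₁p.isSelfAdjoint.star_eq] using congrArg star hPE₁
      rw [← h1, ← mul_apply_eq_comp, h2, hE₁v]
    have hQv : Q v = 0 := by
      have h1 : E₂ (Q v) = Q v := Submodule.starProjection_eq_self_iff.mpr
        ⟨L.starProjection_apply_mem v, (Submodule.starProjection_apply_eq_zero_iff M).mp hPQ⟩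
      have h2 : E₂ * Q = E₂ := by
        simpa [hQp.isSelfAdjoint.star_eq, hE₂p.isSelfAdjoint.star_eq] using congrArg star hQE₂
      rw [← h1, ← mul_apply_eq_comp, h2, hE₂v]
    simpa [hPv, hQv] using hBB
  · have hX : B + (j - star j) - 1 - (Q * (P - Q) - (P - Q) * P) = E₂ * j - star j * E₂ := by
      have h2 : (2 : H →L[ℂ] H) = 1 + 1 := one_add_one_eq_two.symm
      have hEj' : star j * E₂ = star j := by
        simpa [hE₂p.isSelfAdjoint.star_eq] using congrArg star hEj
      rw [hEj, hEj', hB, h2]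
      simp only [mul_sub, sub_mul, add_mul, one_mul, hPp.isIdempotentElem.eq,
        hQp.isIdempotentElem.eq]
      abel
    rw [hX]
    have hle : ((E₂ * j - star j * E₂ : H →L[ℂ] H) : H →ₗ[ℂ] H).range ≤
        (L ⊓ Mᗮ) ⊔ (L ⊓ Mᗮ).map ((star j : H →L[ℂ] H) : H →ₗ[ℂ] H) := by
      rintro _ ⟨x, rfl⟩
      exact sub_mem (Submodule.mem_sup_left (m₂ (j x)))
        (Submodule.mem_sup_right ⟨E₂ x, m₂ x, rfl⟩)
    exact Submodule.finiteDimensional_of_le hle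

end Intertwiner

/-! ### Conjugating projections by invertible operators -/

section Conjugation

/-- Any conjugate of `P` is idempotent; that `u* u` commutes with `P` is what makes it self-adjoint.
-/
theorem IsStarProjection.units_conj {R : Type*} [Ring R] [StarRing R] {P : R}
    (hP : IsStarProjection P) (u : Rˣ) (hu : Commute (star (u : R) * u) P) :
    IsStarProjection ((u : R) * P * ↑u⁻¹) := by
  refine ⟨?_, ?_⟩
  · change (u : R) * P * ↑u⁻¹ * (↑u * P * ↑u⁻¹) = _
    calc (u : R) * P * ↑u⁻¹ * (↑u * P * ↑u⁻¹) = ↑u * P * (↑u⁻¹ * ↑u) * P * ↑u⁻¹ := by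
          simp only [mul_assoc]
      _ = ↑u * (P * P) * ↑u⁻¹ := by rw [Units.inv_mul, mul_one, mul_assoc (u : R) P P]
      _ = _ := by rw [hP.isIdempotentElem.eq]
  · have h1 : star (↑u⁻¹ : R) * star (u : R) = 1 := by rw [← star_mul, Units.mul_inv, star_one]
    change star _ = _
    rw [star_mul, star_mul, hP.isSelfAdjoint.star_eq]
    calc star (↑u⁻¹ : R) * (P * star (u : R)) =
          star (↑u⁻¹ : R) * (P * (star (u : R) * u)) * ↑u⁻¹ := by
            simp only [mul_assoc, Units.mul_inv, mul_one]
      _ = star (↑u⁻¹ : R) * ((star (u : R) * u) * P) * ↑u⁻¹ := by rw [hu.eq]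
      _ = (star (↑u⁻¹ : R) * star (u : R)) * u * P * ↑u⁻¹ := by simp only [mul_assoc]
      _ = _ := by rw [h1, one_mul]

/-- Polar decomposition: `v` plays the part of `|u|`, and `V = u v⁻¹`. -/
theorem unitary_of_units_intertwiner {R : Type*} [Ring R] [StarRing R] {P Q : R} (u v : Rˣ)
    (hv : star (v : R) = v) (huv : (v : R) * v = star (u : R) * u) (hvP : Commute (v : R) P)
    (huP : (u : R) * P = Q * u) : ∃ V ∈ unitary R, Q = V * P * star V := by
  have hvs : star (↑v⁻¹ : R) = ↑v⁻¹ := by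
    have : star v = v := Units.ext (by rw [Units.coe_star, hv])
    rw [← Units.coe_star_inv, this]
  have hvP' : (↑v⁻¹ : R) * P = P * ↑v⁻¹ := hvP.units_inv_left.eq
  have h1 : star ((u : R) * ↑v⁻¹) * ((u : R) * ↑v⁻¹) = 1 := by
    rw [star_mul, hvs, mul_assoc, ← mul_assoc (star (u : R)), ← huv, mul_assoc (v : R),
      Units.mul_inv, mul_one, Units.inv_mul]
  have h2 : ((u : R) * ↑v⁻¹) * star ((u : R) * ↑v⁻¹) = 1 := by
    have := (u * v⁻¹).isUnit
    rw [Units.val_mul] at this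
    exact (this.mul_left_inj).mp (by rw [mul_assoc, h1, mul_one, one_mul])
  refine ⟨u * ↑v⁻¹, Unitary.mem_iff.mpr ⟨h1, h2⟩, ?_⟩
  rw [mul_assoc (u : R), hvP', ← mul_assoc, huP, mul_assoc Q, mul_assoc Q, h2, mul_one]

universe u

variable {H : Type u} [NormedAddCommGroup H] [InnerProductSpace ℂ H] [CompleteSpace H]

/-- The Fredholm alternative at `-1`. -/
theorem isUnit_one_add_of_isCompactOperator {C : H →L[ℂ] H} (hC : IsCompactOperator C)
    (hinj : ∀ v, v + C v = 0 → v = 0) : IsUnit (1 + C) := by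
  rcases hC.hasEigenvalue_or_mem_resolventSet (μ := -1) (by norm_num) with h | h
  · obtain ⟨v, hv⟩ := h.exists_hasEigenvector
    have h1 : C v = (-1 : ℂ) • v := hv.apply_eq_smul
    exact absurd (hinj v (by rw [h1]; simp)) hv.2
  · rw [spectrum.mem_resolventSet_iff] at h
    have : (1 + C : H →L[ℂ] H) = -(algebraMap ℂ (H →L[ℂ] H) (-1) - C) := by simp [add_comm]
    rw [this]
    exact h.neg

/-- The segment from `1` to an operator. -/
noncomputable def segmentFromOne (X : H →L[ℂ] H) (t : ℝ) : H →L[ℂ] H := 1 + (t : ℂ) • (X - 1)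

/-- At a vector `v` the real part of the quadratic form is `(1 - t)‖v‖² + t‖B v‖²`, which gives
injectivity for `t < 1`; at `t = 1` it is assumed. The Fredholm alternative then gives
invertibility. -/
theorem isUnit_segmentFromOne {X B : H →L[ℂ] H} (hX : IsCompactOperator (X - 1 : H →L[ℂ] H))
    (hB : X + star X = 2 * (star B * B)) (hinj : Function.Injective X) {t : ℝ}
    (ht : t ∈ Set.Icc (0 : ℝ) 1) : IsUnit (segmentFromOne X t) := by
  refine isUnit_one_add_of_isCompactOperator (C := (t : ℂ) • (X - 1)) (hX.smul (t : ℂ))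
    fun v hv => ?_
  rcases ht.2.eq_or_lt with rfl | ht1
  · refine hinj ?_
    simpa using hv
  have hre : RCLike.re ⟪v, X v⟫_ℂ = ‖B v‖ ^ 2 := by
    have h1 := congrArg (fun A : H →L[ℂ] H => RCLike.re ⟪v, A v⟫_ℂ) hB
    have h2 : ⟪v, (star X) v⟫_ℂ = ⟪X v, v⟫_ℂ := by
      rw [ContinuousLinearMap.star_eq_adjoint, ContinuousLinearMap.adjoint_inner_right]
    have h3 : ⟪v, (star B) (B v)⟫_ℂ = ⟪B v, B v⟫_ℂ := by
      rw [ContinuousLinearMap.star_eq_adjoint, ContinuousLinearMap.adjoint_inner_right]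
    have h4 : (2 * (star B * B)) v = (star B) (B v) + (star B) (B v) := by
      rw [two_mul]; rfl
    simp only [h4, add_apply, inner_add_right, h2, h3, map_add, inner_self_eq_norm_sq] at h1
    rw [inner_re_symm (X v) v] at h1
    linarith
  have h0 := congrArg (fun w => RCLike.re ⟪v, w⟫_ℂ) hv
  have hexp : v + ((t : ℂ) • (X - 1)) v = ((1 - t : ℝ) : ℂ) • v + (t : ℂ) • X v := by
    rw [smul_apply, sub_apply, one_apply_eq_self, smul_sub]
    push_cast
    rw [sub_smul, one_smul]
    abel
  simp only [inner_zero_right, map_zero] at h0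
  rw [hexp, inner_add_right, inner_smul_right, inner_smul_right, map_add] at h0
  have e1 : RCLike.re (((1 - t : ℝ) : ℂ) * ⟪v, v⟫_ℂ) = (1 - t) * ‖v‖ ^ 2 := by
    rw [← inner_self_eq_norm_sq (𝕜 := ℂ)]; exact Complex.re_ofReal_mul _ _
  have e2 : RCLike.re ((t : ℂ) * ⟪v, X v⟫_ℂ) = t * ‖B v‖ ^ 2 := by
    rw [← hre]; exact Complex.re_ofReal_mul _ _
  rw [e1, e2] at h0
  have h5 : (1 - t) * ‖v‖ ^ 2 = 0 := by
    have := mul_nonneg (sub_nonneg.mpr ht1.le) (sq_nonneg ‖v‖)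
    have := mul_nonneg ht.1 (sq_nonneg ‖B v‖)
    linarith
  rcases mul_eq_zero.mp h5 with h | h
  · linarith
  · exact norm_eq_zero.mp (pow_eq_zero_iff two_ne_zero |>.mp h)

/-- The product is a combination of `1`, `X + X* = 2 B*B` and `X*X`, each commuting with `P`. -/
theorem commute_star_segmentFromOne {X B P : H →L[ℂ] H} (hXX : Commute (star X * X) P)
    (hB : X + star X = 2 * (star B * B)) (hBP : Commute (star B * B) P) (t : ℝ) :
    Commute (star (segmentFromOne X t) * segmentFromOne X t) P := by
  have h : star (segmentFromOne X t) * segmentFromOne X t =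
      ((1 - t : ℂ) ^ 2) • (1 : H →L[ℂ] H) + ((t : ℂ) * (1 - t)) • (X + star X) +
        ((t : ℂ) ^ 2) • (star X * X) := by
    simp only [segmentFromOne, star_add, star_one, star_smul, star_sub, RCLike.star_def,
      Complex.conj_ofReal, mul_add, add_mul, mul_sub, sub_mul, smul_sub, smul_mul_assoc,
      mul_smul_comm, one_mul, mul_one, smul_smul, smul_add]
    module
  rw [h, hB]
  refine Commute.add_left (Commute.add_left ?_ ?_) ?_
  · exact (Commute.one_left P).smul_left _
  · exact (((Commute.ofNat_left 2 P).mul_left hBP)).smul_left _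
  · exact hXX.smul_left _

/-- An invertible operator that intertwines two projections compatibly with the adjoints gives a
unitary operator that intertwines them. -/
theorem exists_unitary_of_intertwiner {X P Q : H →L[ℂ] H} (hX : IsUnit X) (hXP : X * P = Q * X)
    (hc : Commute (star X * X) P) :
    ∃ V ∈ unitary (H →L[ℂ] H), Q = V * P * star V := by
  have h0 : 0 ≤ star X * X := star_mul_self_nonneg X
  -- `S = |X|` commutes with `P` by functional calculus, and is invertible because its square is.
  set S := CFC.sqrt (star X * X) with hS
  have hSS : S * S = star X * X := CFC.sqrt_mul_sqrt_self _ h0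
  have hSs : star S = S := (CFC.sqrt_nonneg _).isSelfAdjoint.star_eq
  have hSP : Commute S P := by
    rw [hS, CFC.sqrt]
    exact hc.cfcₙ_nnreal _
  have hSu : IsUnit S := by
    refine ((Commute.refl S).isUnit_mul_iff.mp ?_).1
    rw [hSS]
    exact hX.star.mul hX
  obtain ⟨u, rfl⟩ := hX
  obtain ⟨v, hv⟩ := hSu
  exact unitary_of_units_intertwiner u v (by rw [hv, hSs]) (by rw [hv, hSS]) (hv ▸ hSP) hXP

end Conjugation

/-! ### Paths of projections -/

section Path

universe u

variable {H : Type u} [NormedAddCommGroup H] [InnerProductSpace ℂ H] [CompleteSpace H] {p : ℝ}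

theorem tendsto_traceAbsPow_mul {α : Type*} {l : Filter α} (hp : 0 < p) {T : H →L[ℂ] H}
    (hT : IsSchatten p T) {A B : α → (H →L[ℂ] H)}
    (h : Filter.Tendsto (fun a => ‖A a‖ * ‖B a‖) l (nhds 0)) :
    Filter.Tendsto (fun a => traceAbsPow p (A a * T * B a)) l (nhds 0) := by
  have h1 : Filter.Tendsto (fun a => (‖A a‖ₑ * ‖B a‖ₑ) ^ p * traceAbsPow p T) l (nhds 0) := by
    have h2 : Filter.Tendsto (fun a => ENNReal.ofReal (‖A a‖ * ‖B a‖)) l (nhds 0) := by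
      simpa using ENNReal.tendsto_ofReal h
    have h3 := ((ENNReal.continuous_rpow_const (y := p)).tendsto 0).comp h2
    rw [ENNReal.zero_rpow_of_pos hp] at h3
    have h4 := ENNReal.Tendsto.mul_const h3 (Or.inr hT.ne)
    rw [zero_mul] at h4
    refine h4.congr fun a => ?_
    rw [Function.comp_apply, ENNReal.ofReal_mul (norm_nonneg _), ofReal_norm, ofReal_norm]
  refine tendsto_of_tendsto_of_tendsto_of_le_of_le tendsto_const_nhds h1 (fun _ => zero_le)
    fun a => ?_
  exact traceAbsPow_comp_le hp (A a) T (B a)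

theorem tendsto_traceAbsPow_add {α : Type*} {l : Filter α} (hp : 1 ≤ p) {S T : α → (H →L[ℂ] H)}
    (hS : Filter.Tendsto (fun a => traceAbsPow p (S a)) l (nhds 0))
    (hT : Filter.Tendsto (fun a => traceAbsPow p (T a)) l (nhds 0)) :
    Filter.Tendsto (fun a => traceAbsPow p (S a + T a)) l (nhds 0) := by
  have h1 := ENNReal.Tendsto.const_mul (a := 2 * 2 ^ (p - 1)) (hS.add hT) (Or.inr
    (ENNReal.mul_ne_top (by simp) (ENNReal.rpow_ne_top_of_nonneg (by linarith) (by simp))))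
  rw [add_zero, mul_zero] at h1
  exact tendsto_of_tendsto_of_tendsto_of_le_of_le tendsto_const_nhds h1 (fun _ => zero_le)
    fun a => traceAbsPow_add_le hp (S a) (T a)

/-- Two projections whose difference is in the Schatten class and which have index zero are joined
by a path of projections that is continuous for the Schatten norm. -/
theorem exists_path {M L : Submodule ℂ H} [CompleteSpace M] [CompleteSpace L] (hp : 1 ≤ p)
    (h : IsSchatten p (M.starProjection - L.starProjection)) (hind : pairIndex M L = 0) :
    ∃ γ : ℝ → (H →L[ℂ] H), γ 0 = M.starProjection ∧ γ 1 = L.starProjection ∧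
      (∀ t ∈ Set.Icc (0 : ℝ) 1, IsStarProjection (γ t) ∧ IsSchatten p (γ t - M.starProjection)) ∧
      ∀ s ∈ Set.Icc (0 : ℝ) 1, Filter.Tendsto (fun t => traceAbsPow p (γ t - γ s))
        (nhdsWithin s (Set.Icc 0 1)) (nhds 0) := by
  have hp0 : 0 < p := one_pos.trans_le hp
  obtain ⟨X, B, hXP, hn, hc, hB, hBP, hinj, hfin⟩ :=
    exists_intertwiner (isCompactOperator_of_isSchatten hp0 h) hind
  set P := M.starProjection with hPdef
  set Q := L.starProjection with hQdef
  have hPp : IsStarProjection P := isStarProjection_starProjection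
  have hX : IsSchatten p (X - 1) := by
    rw [← sub_add_cancel (X - 1) (Q * (P - Q) - (P - Q) * P)]
    exact (IsSchatten.of_finiteDimensional_range hp0 hfin).add hp
      ((h.mul_left hp0 Q).sub hp (h.mul_right hp0 P))
  have hu : ∀ t ∈ Set.Icc (0 : ℝ) 1, IsUnit (segmentFromOne X t) := fun t ht =>
    isUnit_segmentFromOne (isCompactOperator_of_isSchatten hp0 hX) hB hinj ht
  have hdiff : ∀ t s : ℝ, segmentFromOne X t - segmentFromOne X s = ((t - s : ℝ) : ℂ) • (X - 1) := by
    intro t s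
    simp only [segmentFromOne, Complex.ofReal_sub, sub_smul]
    abel
  -- Conjugation of `P` along the segment. `Ring.inverse` makes the formula total; it is a true
  -- inverse on `[0, 1]`.
  refine ⟨fun t => segmentFromOne X t * P * Ring.inverse (segmentFromOne X t), ?_, ?_, ?_, ?_⟩
  · simp [segmentFromOne]
  · have h1 := hu 1 (by simp)
    have : segmentFromOne X 1 = X := by simp [segmentFromOne]
    dsimp only
    rw [this] at h1 ⊢
    rw [hXP, mul_assoc, Ring.mul_inverse_cancel _ h1, mul_one]
  · intro t ht
    obtain ⟨u, hut⟩ := hu t ht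
    have hcu := commute_star_segmentFromOne hc hB hBP t
    dsimp only
    rw [← hut] at hcu ⊢
    rw [Ring.inverse_unit]
    refine ⟨IsStarProjection.units_conj hPp u hcu, ?_⟩
    have h1 : IsSchatten p ((u : H →L[ℂ] H) - 1) := by
      have := hdiff t 0
      rw [← hut] at this
      simp only [segmentFromOne, sub_zero, Complex.ofReal_zero, zero_smul, add_zero] at this
      rw [this]
      simpa using hX.mul_left hp0 ((t : ℂ) • 1)
    have h2 : (u : H →L[ℂ] H) * P * ↑u⁻¹ - P = (((u : H →L[ℂ] H) - 1) * P -
        P * ((u : H →L[ℂ] H) - 1)) * ↑u⁻¹ := by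
      simp only [sub_mul, mul_sub, one_mul, mul_one, mul_assoc, Units.mul_inv]
      abel
    rw [h2]
    exact ((h1.mul_right hp0 P).sub hp (h1.mul_left hp0 P)).mul_right hp0 _
  · intro s hs
    set Y := segmentFromOne X with hY
    have hYc : Continuous Y := by
      rw [hY]
      unfold segmentFromOne
      fun_prop
    obtain ⟨u, hus⟩ := hu s hs
    have hinv : Filter.Tendsto (fun t => Ring.inverse (Y t)) (nhdsWithin s (Set.Icc 0 1))
        (nhds (Ring.inverse (Y s))) := by
      have h1 := NormedRing.inverse_continuousAt u
      rw [hus] at h1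
      exact (h1.tendsto.comp hYc.continuousAt.tendsto).mono_left nhdsWithin_le_nhds
    have hsub : Filter.Tendsto (fun t : ℝ => ((t - s : ℝ) : ℂ)) (nhdsWithin s (Set.Icc 0 1))
        (nhds 0) := by
      have : Continuous fun t : ℝ => ((t - s : ℝ) : ℂ) := by fun_prop
      simpa using (this.tendsto s).mono_left nhdsWithin_le_nhds
    -- With `Y t⁻¹ - Y s⁻¹ = -Y t⁻¹ (Y t - Y s) Y s⁻¹`, each term of the difference contains the
    -- Schatten operator `X - 1` and the scalar `t - s`. Norm continuity of the inverse bounds the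
    -- other factors.
    have key : ∀ t ∈ Set.Icc (0 : ℝ) 1, Y t * P * Ring.inverse (Y t) - Y s * P * Ring.inverse (Y s) =
        (((t - s : ℝ) : ℂ) • (1 : H →L[ℂ] H)) * (X - 1) * (P * Ring.inverse (Y t)) +
        (-((t - s : ℝ) : ℂ) • (Y s * P * Ring.inverse (Y t))) * (X - 1) * Ring.inverse (Y s) := by
      intro t ht
      have h1 : (((t - s : ℝ) : ℂ) • (1 : H →L[ℂ] H)) * (X - 1) = Y t - Y s := by
        rw [hdiff, smul_mul_assoc, one_mul]
      have h2 : (-((t - s : ℝ) : ℂ) • (Y s * P * Ring.inverse (Y t))) * (X - 1) =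
          -(Y s * P * Ring.inverse (Y t) * (Y t - Y s)) := by
        rw [hdiff, smul_mul_assoc, mul_smul_comm, neg_smul]
      rw [h1, h2, mul_sub, mul_assoc _ _ (Y t), Ring.inverse_mul_cancel _ (hu t ht), mul_one]
      have h3 : Y s * P * Ring.inverse (Y t) * Y s * Ring.inverse (Y s) =
          Y s * P * Ring.inverse (Y t) := by
        rw [mul_assoc _ (Y s), Ring.mul_inverse_cancel _ (hu s hs), mul_one]
      rw [neg_mul, sub_mul, sub_mul, h3]
      simp only [mul_assoc]
      abel
    have hev : ∀ᶠ t in nhdsWithin s (Set.Icc (0 : ℝ) 1), t ∈ Set.Icc (0 : ℝ) 1 :=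
      self_mem_nhdsWithin
    refine Filter.Tendsto.congr' (hev.mono fun t ht => congrArg (traceAbsPow p) (key t ht).symm) ?_
    refine tendsto_traceAbsPow_add hp (tendsto_traceAbsPow_mul hp0 hX ?_)
      (tendsto_traceAbsPow_mul hp0 hX ?_)
    · have := (hsub.smul_const (1 : H →L[ℂ] H)).norm.mul (hinv.const_mul P).norm
      simpa using this
    · have := ((hsub.neg.smul (hinv.const_mul (Y s * P))).norm).mul_const ‖Ring.inverse (Y s)‖
      simpa using this

end Path

/-! ### Unitary equivalence of projections -/

section UnitaryEquivalence

universe u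

variable {H : Type u} [NormedAddCommGroup H] [InnerProductSpace ℂ H] [CompleteSpace H]

/-- Two projections with compact difference and index zero are unitarily equivalent. -/
theorem exists_unitary_of_pairIndex_eq_zero {M L : Submodule ℂ H} [CompleteSpace M]
    [CompleteSpace L] (h : IsCompactOperator (M.starProjection - L.starProjection))
    (hind : pairIndex M L = 0) :
    ∃ V ∈ unitary (H →L[ℂ] H), L.starProjection = V * M.starProjection * star V := by
  obtain ⟨X, B, hXP, hn, hc, hB, hBP, hinj, hfin⟩ := exists_intertwiner h hind
  have hX : IsCompactOperator (X - 1 : H →L[ℂ] H) := by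
    rw [← sub_add_cancel (X - 1) (L.starProjection * (M.starProjection - L.starProjection) -
      (M.starProjection - L.starProjection) * M.starProjection)]
    have h1 : IsCompactOperator (L.starProjection * (M.starProjection - L.starProjection) :
        H →L[ℂ] H) := h.clm_comp L.starProjection
    have h2 : IsCompactOperator ((M.starProjection - L.starProjection) * M.starProjection :
        H →L[ℂ] H) := h.comp_clm M.starProjection
    have h3 := @isCompactOperator_of_finiteDimensional_range _ _ _ _ _ _ _ hfin
    exact h3.add (h1.sub h2)
  have hu : IsUnit X := by
    have := isUnit_segmentFromOne hX hB hinj (t := 1) (by simp)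
    simpa [segmentFromOne] using this
  exact exists_unitary_of_intertwiner hu hXP hc

/-- An orthonormal basis adapted to a closed subspace and its complement. -/
theorem exists_hilbertBasis_sum (K : Submodule ℂ H) [CompleteSpace K] :
    ∃ (ι ι' : Type u) (v : HilbertBasis (ι ⊕ ι') ℂ H), (∀ i, v (Sum.inl i) ∈ K) ∧
      (∀ j, v (Sum.inr j) ∈ Kᗮ) ∧ (¬ FiniteDimensional ℂ K → Infinite ι) ∧
      (¬ FiniteDimensional ℂ Kᗮ → Infinite ι') := by
  have key : ∀ L : Submodule ℂ H, CompleteSpace L → ∃ (ι : Type u) (b : HilbertBasis ι ℂ L),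
      (¬ FiniteDimensional ℂ L → Infinite ι) := by
    intro L _
    obtain ⟨w, b, -⟩ := exists_hilbertBasis ℂ L
    refine ⟨w, b, fun h => ?_⟩
    by_contra hfin
    rw [not_infinite_iff_finite] at hfin
    have := Fintype.ofFinite w
    exact h (b.toOrthonormalBasis.toBasis.finiteDimensional_of_finite)
  obtain ⟨ι, b, hb⟩ := key K inferInstance
  obtain ⟨ι', b', hb'⟩ := key Kᗮ inferInstance
  set v : ι ⊕ ι' → H := Sum.elim (fun i => (b i : H)) (fun j => (b' j : H)) with hv
  have hon : Orthonormal ℂ v := by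
    constructor
    · rintro (i | j)
      · exact b.orthonormal.1 i
      · exact b'.orthonormal.1 j
    · rintro (i | i) (j | j) hij
      · exact b.orthonormal.2 (fun h => hij (by rw [h]))
      · exact Submodule.inner_right_of_mem_orthogonal (b i).2 (b' j).2
      · exact Submodule.inner_left_of_mem_orthogonal (b j).2 (b' i).2
      · exact b'.orthonormal.2 (fun h => hij (by rw [h]))
  have hsub : ∀ (L : Submodule ℂ H) (κ : Type u) (c : HilbertBasis κ ℂ L) (x : H),
      (∀ k, ⟪(c k : H), x⟫_ℂ = 0) → ∀ y ∈ L, ⟪y, x⟫_ℂ = 0 := by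
    intro L κ c x hx y hy
    have h1 : (innerSL ℂ x) ∘L L.subtypeL = 0 := by
      refine ContinuousLinearMap.ext_on
        ((Submodule.dense_iff_topologicalClosure_eq_top).mpr c.dense_span) ?_
      rintro _ ⟨k, rfl⟩
      simpa using inner_eq_zero_symm.mp (hx k)
    have := congrArg (fun f => f ⟨y, hy⟩) h1
    exact inner_eq_zero_symm.mp (by simpa using this)
  have hsp : (Submodule.span ℂ (Set.range v))ᗮ = ⊥ := by
    rw [eq_bot_iff]
    intro x hx
    have hx' : ∀ z, ⟪v z, x⟫_ℂ = 0 := fun z =>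
      Submodule.inner_right_of_mem_orthogonal (Submodule.subset_span (Set.mem_range_self z)) hx
    have h1 : x ∈ Kᗮ := (Submodule.mem_orthogonal _ _).mpr (hsub K ι b x fun k => hx' (Sum.inl k))
    exact (Submodule.mem_bot ℂ).mpr
      (inner_self_eq_zero.mp (hsub Kᗮ ι' b' x (fun k => hx' (Sum.inr k)) x h1))
  refine ⟨ι, ι', HilbertBasis.mkOfOrthogonalEqBot hon hsp, fun i => ?_, fun j => ?_, hb, hb'⟩
  · rw [HilbertBasis.coe_mkOfOrthogonalEqBot]
    exact (b i).2
  · rw [HilbertBasis.coe_mkOfOrthogonalEqBot]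
    exact (b' j).2

/-- A permutation of the indices of an orthonormal basis acts as a unitary operator. -/
theorem exists_linearIsometryEquiv_of_perm {κ : Type*} (v : HilbertBasis κ ℂ H)
    (σ : Equiv.Perm κ) : ∃ W : H ≃ₗᵢ[ℂ] H, ∀ k, W (v k) = v (σ k) := by
  classical
  have hon : Orthonormal ℂ (v ∘ σ) := v.orthonormal.comp σ σ.injective
  have hsp : (Submodule.span ℂ (Set.range (v ∘ σ)))ᗮ = ⊥ := by
    rw [σ.surjective.range_comp, ← Submodule.topologicalClosure_eq_top_iff]
    exact v.dense_span
  refine ⟨v.repr.trans (HilbertBasis.mkOfOrthogonalEqBot hon hsp).repr.symm, fun k => ?_⟩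
  rw [LinearIsometryEquiv.trans_apply, HilbertBasis.repr_self, HilbertBasis.repr_symm_single,
    HilbertBasis.coe_mkOfOrthogonalEqBot]
  rfl

/-- Hilbert's hotel: `Option ι ≃ ι` and `Option ι' ≃ ι'`, and `m` moves the extra point from the
left summand to the right one. -/
theorem exists_perm_sum (ι ι' : Type u) [Infinite ι] [Infinite ι'] :
    ∃ (σ : Equiv.Perm (ι ⊕ ι')) (j₀ : ι') (i₀ : ι), σ (Sum.inl i₀) = Sum.inr j₀ ∧
      (∀ i, i ≠ i₀ → ∃ i', σ (Sum.inl i) = Sum.inl i') ∧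
      ∀ j, ∃ j', j' ≠ j₀ ∧ σ (Sum.inr j) = Sum.inr j' := by
  have h : ∀ α : Type u, Infinite α → Nonempty (Option α ≃ α) := fun α _ => by
    rw [← Cardinal.eq, Cardinal.mk_option]
    exact Cardinal.add_one_eq (Cardinal.aleph0_le_mk α)
  obtain ⟨e⟩ := h ι inferInstance
  obtain ⟨e'⟩ := h ι' inferInstance
  let m : Option ι ⊕ ι' ≃ ι ⊕ Option ι' :=
    { toFun := Sum.elim (fun o => o.elim (Sum.inr none) Sum.inl) (fun j => Sum.inr (some j))
      invFun := Sum.elim (fun i => Sum.inl (some i)) (fun o => o.elim (Sum.inl none) Sum.inr)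
      left_inv := by rintro ((_ | i) | j) <;> rfl
      right_inv := by rintro (i | (_ | j)) <;> rfl }
  refine ⟨((Equiv.sumCongr e (Equiv.refl ι')).symm.trans m).trans
    (Equiv.sumCongr (Equiv.refl ι) e'), e' none, e none, ?_, fun i hi => ?_, fun j => ?_⟩
  · simp [m]
  · obtain ⟨o, rfl⟩ := e.surjective i
    cases o with
    | none => exact absurd rfl hi
    | some i => exact ⟨i, by simp [m]⟩
  · exact ⟨e' (some j), by simp, by simp [m]⟩

instance completeSpace_map (K : Submodule ℂ H) [CompleteSpace K] (W : H ≃ₗᵢ[ℂ] H) :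
    CompleteSpace (K.map (W.toLinearEquiv : H →ₗ[ℂ] H)) := by
  have h : IsComplete (K : Set H) := completeSpace_coe_iff_isComplete.mp inferInstance
  refine completeSpace_coe_iff_isComplete.mpr ?_
  rw [Submodule.map_coe]
  exact (isComplete_image_iff W.isometry.isUniformInducing).mpr h

/-- A closed subspace of infinite dimension and codimension has a unitary image of relative
index one. -/
theorem exists_shift (K : Submodule ℂ H) [CompleteSpace K] (hK : ¬ FiniteDimensional ℂ K)
    (hK' : ¬ FiniteDimensional ℂ Kᗮ) : ∃ W : H ≃ₗᵢ[ℂ] H,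
      FiniteDimensional ℂ (((K.map (W.toLinearEquiv : H →ₗ[ℂ] H)).starProjection -
        K.starProjection : H →L[ℂ] H) : H →ₗ[ℂ] H).range ∧
      pairIndex (K.map (W.toLinearEquiv : H →ₗ[ℂ] H)) K = 1 := by
  obtain ⟨ι, ι', v, hvK, hvK', hι, hι'⟩ := exists_hilbertBasis_sum K
  have := hι hK
  have := hι' hK'
  obtain ⟨σ, j₀, i₀, h₀, h₁, h₂⟩ := exists_perm_sum ι ι'
  obtain ⟨W, hW⟩ := exists_linearIsometryEquiv_of_perm v σ
  set e : H := v (Sum.inr j₀) with he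
  have hnorm : ‖e‖ = 1 := v.orthonormal.1 _
  have he0 : e ≠ 0 := fun h => by simp [h] at hnorm
  set R : H →L[ℂ] H := (ℂ ∙ e).starProjection with hR
  have hRv : ∀ k, k ≠ Sum.inr j₀ → R (v k) = 0 := fun k hk => by
    rw [hR, Submodule.starProjection_unit_singleton ℂ hnorm, he, v.orthonormal.2 (Ne.symm hk),
      zero_smul]
  have hRe : R e = e := by
    rw [hR]
    exact Submodule.starProjection_eq_self_iff.mpr (Submodule.mem_span_singleton_self e)
  have hEl : ∀ i, K.starProjection (v (Sum.inl i)) = v (Sum.inl i) := fun i =>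
    Submodule.starProjection_eq_self_iff.mpr (hvK i)
  have hEr : ∀ j, K.starProjection (v (Sum.inr j)) = 0 := fun j =>
    (Submodule.starProjection_apply_eq_zero_iff K).mpr (hvK' j)
  set M := K.map (W.toLinearEquiv : H →ₗ[ℂ] H) with hM
  -- `W` carries the basis of `K` onto that basis together with `e`, which lies in `Kᗮ`. Hence `M`
  -- is `K ⊕ ℂ e`, and the relative index is one.
  have hMP : M.starProjection = K.starProjection + R := by
    have h1 : M.starProjection ∘L (W : H →L[ℂ] H) =
        (K.starProjection + R) ∘L (W : H →L[ℂ] H) := by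
      refine ContinuousLinearMap.ext_on
        ((Submodule.dense_iff_topologicalClosure_eq_top).mpr v.dense_span) ?_
      rintro _ ⟨k, rfl⟩
      have h2 : M.starProjection (W (v k)) = W (K.starProjection (v k)) := by
        have h3 := Submodule.starProjection_map_apply W K (W (v k))
        rwa [LinearIsometryEquiv.symm_apply_apply] at h3
      change M.starProjection (W (v k)) = K.starProjection (W (v k)) + R (W (v k))
      rw [h2]
      rcases k with i | j
      · rw [hEl, hW]
        by_cases hi : i = i₀
        · rw [hi, h₀, hEr, zero_add, hRe]
        · obtain ⟨i', hi'⟩ := h₁ i hi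
          rw [hi', hEl, hRv _ (by simp), add_zero]
      · obtain ⟨j', hj', hj⟩ := h₂ j
        rw [hEr, hW, hj, hEr, hRv _ (by simpa using hj'), map_zero, add_zero]
    ext x
    have := congrArg (fun f => f (W.symm x)) h1
    simpa using this
  have hMK : M ⊓ Kᗮ = ℂ ∙ e := by
    refine le_antisymm ?_ ?_
    · rintro x ⟨hxM, hxK⟩
      have h1 : M.starProjection x = x := Submodule.starProjection_eq_self_iff.mpr hxM
      rw [hMP, add_apply, (Submodule.starProjection_apply_eq_zero_iff K).mpr hxK, zero_add] at h1
      rw [← h1]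
      exact Submodule.starProjection_apply_mem _ _
    · rw [Submodule.span_singleton_le_iff_mem]
      refine ⟨?_, hvK' j₀⟩
      refine Submodule.starProjection_eq_self_iff.mp ?_
      rw [hMP, add_apply, hRe, he, hEr, zero_add]
  have hKM : K ⊓ Mᗮ = ⊥ := by
    rw [eq_bot_iff]
    rintro x ⟨hxK, hxM⟩
    have h1 : M.starProjection x = 0 := (Submodule.starProjection_apply_eq_zero_iff M).mpr hxM
    have h2 : R x = 0 := by
      refine (Submodule.starProjection_apply_eq_zero_iff _).mpr ?_
      rw [Submodule.mem_orthogonal_singleton_iff_inner_right]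
      exact Submodule.inner_left_of_mem_orthogonal hxK (hvK' j₀)
    rw [hMP, add_apply, h2, Submodule.starProjection_eq_self_iff.mpr hxK, add_zero] at h1
    exact h1
  refine ⟨W, ?_, ?_⟩
  · rw [hMP, add_sub_cancel_left]
    refine Submodule.finiteDimensional_of_le (S₂ := ℂ ∙ e) ?_
    rintro _ ⟨x, rfl⟩
    exact Submodule.starProjection_apply_mem _ _
  · rw [pairIndex, hMK, hKM, finrank_span_singleton he0]
    simp

omit [CompleteSpace H] in
theorem pairIndex_map (M L : Submodule ℂ H) (W : H ≃ₗᵢ[ℂ] H) :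
    pairIndex (M.map (W.toLinearEquiv : H →ₗ[ℂ] H)) (L.map (W.toLinearEquiv : H →ₗ[ℂ] H)) =
      pairIndex M L := by
  have h : ∀ A B : Submodule ℂ H, Module.finrank ℂ (A.map (W.toLinearEquiv : H →ₗ[ℂ] H) ⊓
      (B.map (W.toLinearEquiv : H →ₗ[ℂ] H))ᗮ : Submodule ℂ H) =
      Module.finrank ℂ (A ⊓ Bᗮ : Submodule ℂ H) := by
    intro A B
    rw [← Submodule.map_orthogonal_equiv, ← Submodule.map_inf _ W.injective]
    exact LinearEquiv.finrank_map_eq W.toLinearEquiv _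
  rw [pairIndex, pairIndex, h, h]

omit [CompleteSpace H] in
theorem starProjection_map (M : Submodule ℂ H) [CompleteSpace M] (W : H ≃ₗᵢ[ℂ] H) :
    (M.map (W.toLinearEquiv : H →ₗ[ℂ] H)).starProjection =
      (W : H →L[ℂ] H) ∘L M.starProjection ∘L (W.symm : H →L[ℂ] H) := by
  ext x
  exact Submodule.starProjection_map_apply W M x

theorem isSchatten_starProjection_map_sub {p : ℝ} (hp : 0 < p) {M L : Submodule ℂ H}
    [CompleteSpace M] [CompleteSpace L] (W : H ≃ₗᵢ[ℂ] H)
    (h : IsSchatten p (M.starProjection - L.starProjection)) :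
    IsSchatten p ((M.map (W.toLinearEquiv : H →ₗ[ℂ] H)).starProjection -
      (L.map (W.toLinearEquiv : H →ₗ[ℂ] H)).starProjection) := by
  have e : (M.map (W.toLinearEquiv : H →ₗ[ℂ] H)).starProjection -
      (L.map (W.toLinearEquiv : H →ₗ[ℂ] H)).starProjection =
      (W : H →L[ℂ] H) ∘L (M.starProjection - L.starProjection) ∘L (W.symm : H →L[ℂ] H) := by
    rw [starProjection_map, starProjection_map]
    ext x
    simp
  rw [e]
  exact h.comp hp _ _

/-- Unitary images of a closed subspace of infinite dimension and codimension attain every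
relative index. -/
theorem exists_linearIsometryEquiv_pairIndex_eq {p : ℝ} (hp : 1 ≤ p) (K : Submodule ℂ H)
    [CompleteSpace K] (hK : ¬ FiniteDimensional ℂ K) (hK' : ¬ FiniteDimensional ℂ Kᗮ) (k : ℤ) :
    ∃ W : H ≃ₗᵢ[ℂ] H,
      IsSchatten p ((K.map (W.toLinearEquiv : H →ₗ[ℂ] H)).starProjection - K.starProjection) ∧
      pairIndex (K.map (W.toLinearEquiv : H →ₗ[ℂ] H)) K = k := by
  have hp0 : 0 < p := one_pos.trans_le hp
  -- Indices add under composition: the pair `(W V K, K)` splits at `W K`, and `W` preserves the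
  -- index of `(V K, K)`. Powers of the shift and of its inverse then give every integer.
  have step : ∀ V W : H ≃ₗᵢ[ℂ] H,
      IsSchatten p ((K.map (V.toLinearEquiv : H →ₗ[ℂ] H)).starProjection - K.starProjection) →
      IsSchatten p ((K.map (W.toLinearEquiv : H →ₗ[ℂ] H)).starProjection - K.starProjection) →
      IsSchatten p ((K.map ((V.trans W).toLinearEquiv : H →ₗ[ℂ] H)).starProjection -
          K.starProjection) ∧
        pairIndex (K.map ((V.trans W).toLinearEquiv : H →ₗ[ℂ] H)) K =
          pairIndex (K.map (V.toLinearEquiv : H →ₗ[ℂ] H)) K +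
            pairIndex (K.map (W.toLinearEquiv : H →ₗ[ℂ] H)) K := by
    intro V W hV hW
    have e : K.map ((V.trans W).toLinearEquiv : H →ₗ[ℂ] H) =
        (K.map (V.toLinearEquiv : H →ₗ[ℂ] H)).map (W.toLinearEquiv : H →ₗ[ℂ] H) := by
      rw [← Submodule.map_comp]
      rfl
    have h1 := isSchatten_starProjection_map_sub hp0 W hV
    have h2 := h1.add hp hW
    rw [sub_add_sub_cancel] at h2
    have h3 := pairIndex_add (isCompactOperator_of_isSchatten hp0 h1)
      (isCompactOperator_of_isSchatten hp0 hW)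
    rw [pairIndex_map] at h3
    simp only [e]
    exact ⟨h2, h3⟩
  obtain ⟨W, hW, hW1⟩ := exists_shift K hK hK'
  have hWs := IsSchatten.of_finiteDimensional_range hp0 hW
  have hid : (K.map (W.toLinearEquiv : H →ₗ[ℂ] H)).map (W.symm.toLinearEquiv : H →ₗ[ℂ] H) = K := by
    rw [← Submodule.map_comp]
    convert Submodule.map_id K
    ext x
    simp
  have hVs : IsSchatten p ((K.map (W.symm.toLinearEquiv : H →ₗ[ℂ] H)).starProjection -
      K.starProjection) := by
    have := (isSchatten_starProjection_map_sub hp0 W.symm hWs).neg hp0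
    simp only [hid, neg_sub] at this
    exact this
  have hV1 : pairIndex (K.map (W.symm.toLinearEquiv : H →ₗ[ℂ] H)) K = -1 := by
    have := pairIndex_map (K.map (W.toLinearEquiv : H →ₗ[ℂ] H)) K W.symm
    rw [hid, hW1] at this
    rw [pairIndex_swap, this]
  induction k using Int.induction_on with
  | zero =>
    have hr : K.map ((LinearIsometryEquiv.refl ℂ H).toLinearEquiv : H →ₗ[ℂ] H) = K :=
      Submodule.map_id K
    refine ⟨LinearIsometryEquiv.refl ℂ H, ?_, ?_⟩
    · simp only [hr, sub_self]
      exact IsSchatten.zero hp0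
    · rw [hr, pairIndex, sub_self]
  | succ k ih =>
    obtain ⟨V, hV, hVk⟩ := ih
    obtain ⟨h1, h2⟩ := step V W hV hWs
    exact ⟨_, h1, by rw [h2, hVk, hW1]⟩
  | pred k ih =>
    obtain ⟨V, hV, hVk⟩ := ih
    obtain ⟨h1, h2⟩ := step V W.symm hV hVs
    exact ⟨_, h1, by rw [h2, hVk, hV1]; ring⟩

end UnitaryEquivalence

/-! ### Adjoints of Schatten operators -/

section Adjoint

universe u

variable {E F : Type u} [NormedAddCommGroup E] [InnerProductSpace ℂ E] [CompleteSpace E]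
  [NormedAddCommGroup F] [InnerProductSpace ℂ F] [CompleteSpace F] {p : ℝ}

/-- With `R` the projection onto the range of `S`, the adjoint of `S = R S` factors through that
range. -/
theorem rank_adjoint_le {S : E →L[ℂ] F} {n : ℕ} (hS : (S : E →ₗ[ℂ] F).rank ≤ n) :
    (S.adjoint : F →ₗ[ℂ] E).rank ≤ n := by
  have hfin : FiniteDimensional ℂ (S : E →ₗ[ℂ] F).range :=
    Module.rank_lt_aleph0_iff.mp (hS.trans_lt Cardinal.natCast_lt_aleph0)
  set R := (S : E →ₗ[ℂ] F).range
  have h1 : R.starProjection ∘L S = S := by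
    ext x
    exact Submodule.starProjection_eq_self_iff.mpr ⟨x, rfl⟩
  have h2 : S.adjoint ∘L R.starProjection = S.adjoint := by
    conv_rhs => rw [← h1]
    rw [ContinuousLinearMap.adjoint_comp,
      (isStarProjection_starProjection (U := R)).isSelfAdjoint.adjoint_eq]
  have h3 : (S.adjoint : F →ₗ[ℂ] E) =
      ((S.adjoint : F →ₗ[ℂ] E) ∘ₗ R.subtype) ∘ₗ (R.orthogonalProjectionOnto : F →ₗ[ℂ] R) := by
    conv_lhs => rw [← h2]
    rfl
  rw [h3]
  refine (LinearMap.rank_comp_le_left _ _).trans ((LinearMap.rank_le_domain _).trans hS)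

theorem approxNumber_adjoint_le (T : E →L[ℂ] F) (n : ℕ) :
    approxNumber T.adjoint n ≤ approxNumber T n := by
  rw [approxNumber.eq_def T]
  refine le_iInf fun S => (approxNumber_le (rank_adjoint_le S.2)).trans_eq ?_
  rw [← map_sub, ← ofReal_norm, ← ofReal_norm, LinearIsometryEquiv.norm_map]

theorem IsSchatten.adjoint (hp : 0 < p) {T : E →L[ℂ] F} (hT : IsSchatten p T) :
    IsSchatten p T.adjoint := by
  unfold IsSchatten at hT ⊢
  rw [traceAbsPow_eq_tsum hp] at hT ⊢
  exact (ENNReal.tsum_le_tsum fun n =>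
    ENNReal.rpow_le_rpow (approxNumber_adjoint_le T n) hp.le).trans_lt hT

end Adjoint

/-! ### Descriptions of the restricted Grassmannian -/

section Characterizations

universe u

variable {H : Type u} [NormedAddCommGroup H] [InnerProductSpace ℂ H] [CompleteSpace H] {p : ℝ}

omit [CompleteSpace H] in
theorem calkin_eq_calkin_iff {A B : H →L[ℂ] H} :
    calkin A = calkin B ↔ IsCompactOperator (A - B : H →L[ℂ] H) := by
  have h1 : calkin A = calkin B ↔ (compactIdeal H).ringCon A B := RingCon.eq _
  rw [h1, TwoSidedIdeal.rel_iff]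
  exact TwoSidedIdeal.mem_mk' ..

/-- Projections with compact difference whose commutator is in the Schatten class differ by an
element of the Schatten class. -/
theorem isSchatten_sub_of_commutator (hp : 1 ≤ p) {P E : H →L[ℂ] H} (hP : IsIdempotentElem P)
    (hE : IsIdempotentElem E) (hc : IsCompactOperator (P - E : H →L[ℂ] H))
    (h : IsSchatten p (P * E - E * P)) : IsSchatten p (P - E) := by
  have hp0 : 0 < p := one_pos.trans_le hp
  have hPE : (P * E - E * P) * (P + E - 1) = (P - E) * (1 - (P - E) * (P - E)) := by
    have h1 : P * E - E * P = (P - E) * (P + E - 1) := by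
      simp only [mul_add, mul_sub, sub_mul, mul_one, hP.eq, hE.eq]
      abel
    have h2 : (P + E - 1) * (P + E - 1) = 1 - (P - E) * (P - E) := by
      simp only [mul_add, mul_sub, sub_mul, add_mul, mul_one, one_mul, hP.eq, hE.eq]
      abel
    rw [h1, mul_assoc, h2]
  have hcc : IsCompactOperator ((P - E) * (P - E) : H →L[ℂ] H) := hc.clm_comp (P - E)
  -- `1 - (P - E)²` need not be invertible, as `±1` may be eigenvalues of `P - E`. Adding the finite
  -- rank `F` gives the invertible `u`, at the cost of the Schatten term `(P - E) F`.
  obtain ⟨F, hF, hFn⟩ := exists_finiteDimensional_range_norm_sub_lt hcc one_pos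
  obtain ⟨u, hu⟩ := isUnit_one_sub_of_norm_lt_one hFn
  have h3 : (P - E) * u = (P * E - E * P) * (P + E - 1) + (P - E) * F := by
    rw [hu, hPE]
    simp only [mul_sub, mul_one]
    abel
  have h4 : P - E = ((P * E - E * P) * (P + E - 1) + (P - E) * F) * ↑u⁻¹ := by
    rw [← h3, mul_assoc, Units.mul_inv, mul_one]
  rw [h4]
  exact ((h.mul_right hp0 _).add hp
    ((IsSchatten.of_finiteDimensional_range hp0 hF).mul_left hp0 _)).mul_right hp0 _

variable {L : Submodule ℂ H} [CompleteSpace L]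

theorem memA_of_isSchatten_sub (hp : 1 ≤ p) {P : H →L[ℂ] H}
    (h : IsSchatten p (P - L.starProjection)) : MemA p L P := by
  have hp0 : 0 < p := one_pos.trans_le hp
  have e : P * L.starProjection - L.starProjection * P =
      (P - L.starProjection) * L.starProjection - L.starProjection * (P - L.starProjection) := by
    simp only [mul_sub, sub_mul]
    abel
  unfold MemA
  rw [e]
  exact (h.mul_right hp0 _).sub hp (h.mul_left hp0 _)

theorem D3_eq (hp : 1 ≤ p) :
    D3 p L = {P | IsStarProjection P ∧ IsSchatten p (P - L.starProjection)} := by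
  ext P
  constructor
  · rintro ⟨⟨hP, hA⟩, hc⟩
    exact ⟨hP, isSchatten_sub_of_commutator hp hP.isIdempotentElem
      (isStarProjection_starProjection (U := L)).isIdempotentElem (calkin_eq_calkin_iff.mp hc) hA⟩
  · rintro ⟨hP, h⟩
    exact ⟨⟨hP, memA_of_isSchatten_sub hp h⟩, calkin_eq_calkin_iff.mpr
      (isCompactOperator_of_isSchatten (one_pos.trans_le hp) h)⟩

/-- The commutators with `E` and `1 - E` differ by a sign; this lets `𝔻₄` be treated as `𝔻₃` for
`Kᗮ`. -/
theorem memA_orthogonal {A : H →L[ℂ] H} (hp : 0 < p) : MemA p Lᗮ A ↔ MemA p L A := by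
  have e : A * Lᗮ.starProjection - Lᗮ.starProjection * A =
      -(A * L.starProjection - L.starProjection * A) := by
    rw [Submodule.starProjection_orthogonal]
    change A * (1 - L.starProjection) - (1 - L.starProjection) * A = _
    simp only [mul_sub, sub_mul, mul_one, one_mul]
    abel
  unfold MemA
  rw [e]
  exact ⟨fun h => by simpa using h.neg hp, fun h => h.neg hp⟩

theorem starProjection_range {P : H →L[ℂ] H} (hP : IsStarProjection P) [CompleteSpace P.range] :
    P.range.starProjection = P := by
  obtain ⟨_, h⟩ := isStarProjection_iff_eq_starProjection_range.mp hP
  exact h.symm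

/-- The commutator appears through `U E U* - E = [U, E] U*`. -/
theorem orbit_subset (hp : 1 ≤ p) :
    orbit p L L.starProjection ⊆ {P | IsStarProjection P ∧ IsSchatten p (P - L.starProjection)} := by
  rintro P ⟨U, ⟨hU, hA, -⟩, rfl⟩
  have hE := isStarProjection_starProjection (U := L)
  have hU1 := (Unitary.mem_iff.mp hU).1
  have hU2 := (Unitary.mem_iff.mp hU).2
  refine ⟨⟨?_, ?_⟩, ?_⟩
  · rw [IsIdempotentElem]
    calc U * L.starProjection * star U * (U * L.starProjection * star U) =
          U * L.starProjection * (star U * U) * L.starProjection * star U := by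
            simp only [mul_assoc]
      _ = _ := by rw [hU1, mul_one, mul_assoc U, hE.isIdempotentElem.eq]
  · exact hE.isSelfAdjoint.conjugate U
  · have e : U * L.starProjection * star U - L.starProjection =
        (U * L.starProjection - L.starProjection * U) * star U := by
      rw [sub_mul, mul_assoc L.starProjection U, hU2, mul_one]
    rw [e]
    exact IsSchatten.mul_right (one_pos.trans_le hp) hA _

/-- Move `L` by a unitary `W` to a subspace with the same index relative to `L` as the range of `P`.
Then `W L` and that range have relative index zero and are conjugate by some unitary `V`. That `U =
V W` is in `𝓐^p` follows afterwards from `[U, E] = (P - E) U`. -/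
theorem subset_orbit (hp : 1 ≤ p) (hL : ¬ FiniteDimensional ℂ L) (hL' : ¬ FiniteDimensional ℂ Lᗮ) :
    {P | IsStarProjection P ∧ IsSchatten p (P - L.starProjection)} ⊆
      orbit p L L.starProjection := by
  rintro P ⟨hP, h⟩
  have hp0 : 0 < p := one_pos.trans_le hp
  have := completeSpace_range hP
  have hPr := starProjection_range hP
  set M : Submodule ℂ H := P.range with hM
  obtain ⟨W, hW, hWk⟩ := exists_linearIsometryEquiv_pairIndex_eq hp L hL hL' (pairIndex M L)
  have h1 : IsSchatten p (L.starProjection - M.starProjection) := by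
    rw [hPr]
    simpa using h.neg hp0
  have h2 := hW.add hp h1
  rw [sub_add_sub_cancel] at h2
  have h3 := pairIndex_add (isCompactOperator_of_isSchatten hp0 hW)
    (isCompactOperator_of_isSchatten hp0 h1)
  rw [hWk, pairIndex_swap (M := L), add_neg_cancel] at h3
  obtain ⟨V, hV, hVP⟩ :=
    exists_unitary_of_pairIndex_eq_zero (isCompactOperator_of_isSchatten hp0 h2) h3
  set Y : unitary (H →L[ℂ] H) := Unitary.linearIsometryEquiv.symm W with hY
  have hYs : star (Y : H →L[ℂ] H) = (W.symm : H →L[ℂ] H) := by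
    rw [← Unitary.coe_star, Unitary.star_eq_inv, hY, ← map_inv]
    rfl
  have hU : V * Y ∈ unitary (H →L[ℂ] H) := mul_mem hV Y.2
  have hPU : P = V * Y * L.starProjection * star (V * (Y : H →L[ℂ] H)) := by
    rw [← hPr, hVP, starProjection_map, star_mul, hYs]
    rfl
  set U : H →L[ℂ] H := V * Y
  have hU1 := (Unitary.mem_iff.mp hU).1
  have hU2 := (Unitary.mem_iff.mp hU).2
  have e1 : U * L.starProjection - L.starProjection * U = (P - L.starProjection) * U := by
    rw [hPU, sub_mul, mul_assoc _ (star U), hU1, mul_one]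
  have e2 : star U * L.starProjection - L.starProjection * star U =
      -(star U * (P - L.starProjection)) := by
    rw [hPU, mul_sub, mul_assoc U, ← mul_assoc (star U) U, hU1, one_mul, neg_sub]
  refine ⟨U, ⟨hU, ?_, ?_⟩, hPU⟩
  · unfold MemA
    rw [e1]
    exact h.mul_right hp0 _
  · unfold MemA
    rw [e2]
    exact (h.mul_left hp0 _).neg hp0

/-- In `P - E = (1 - E)P - E(1 - P)` the first term is the second Grassmannian condition. For the
other, a right parametrix extends to `X` on `H` with `P X = X` and `X - E` in `𝓑_p`; applying `1 -
P` and taking adjoints gives `E(1 - P)`. Conversely, the projection `L → R(P)` is a parametrix. -/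
theorem Gr_eq (hp : 1 ≤ p) :
    Gr L p = {P | IsStarProjection P ∧ IsSchatten p (P - L.starProjection)} := by
  have hp0 : 0 < p := one_pos.trans_le hp
  have hLo : Lᗮ.starProjection = 1 - L.starProjection := Submodule.starProjection_orthogonal ..
  ext P
  constructor
  · rintro ⟨hP, ⟨S, -, hTS⟩, hB⟩
    have := completeSpace_range hP
    refine ⟨hP, ?_⟩
    have hPr := starProjection_range hP
    set X : H →L[ℂ] H := P.range.subtypeL ∘L S ∘L L.orthogonalProjectionOnto with hX
    have hPX : P * X = X := by
      rw [← hPr]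
      ext x
      exact Submodule.starProjection_eq_self_iff.mpr (S _).2
    have h1 : IsSchatten p (Lᗮ.starProjection * P) := by
      have := hB.comp_clm hp0 P.range.orthogonalProjectionOnto
      have e : (Lᗮ.starProjection ∘L P.range.subtypeL) ∘L P.range.orthogonalProjectionOnto =
          Lᗮ.starProjection * P := congrArg (Lᗮ.starProjection * ·) hPr
      rwa [e] at this
    have h2 : IsSchatten p (L.starProjection * X - L.starProjection) := by
      have := hTS.comp hp0 L.subtypeL L.orthogonalProjectionOnto
      have e : L.subtypeL ∘L (restrictedProj L P ∘L S - ContinuousLinearMap.id ℂ L) ∘L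
          L.orthogonalProjectionOnto = L.starProjection * X - L.starProjection := by
        ext x
        simp [restrictedProj, hX]
      rwa [e] at this
    have h3 : IsSchatten p (Lᗮ.starProjection * X) := by
      rw [← hPX, ← mul_assoc]
      exact h1.mul_right hp0 X
    have h4 : IsSchatten p (X - L.starProjection) := by
      have := h3.add hp h2
      have e : Lᗮ.starProjection * X + (L.starProjection * X - L.starProjection) =
          X - L.starProjection := by
        rw [hLo, sub_mul, one_mul]
        abel
      rwa [e] at this
    have h5 : IsSchatten p ((1 - P) * L.starProjection) := by
      have := (h4.mul_left hp0 (1 - P)).neg hp0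
      have e : -((1 - P) * (X - L.starProjection)) = (1 - P) * L.starProjection := by
        rw [mul_sub, sub_mul 1 P X, hPX, one_mul, sub_self, zero_sub, neg_neg]
      rwa [e] at this
    have h6 : IsSchatten p (L.starProjection * (1 - P)) := by
      have := h5.adjoint hp0
      have e : ((1 - P) * L.starProjection).adjoint = L.starProjection * (1 - P) := by
        rw [← ContinuousLinearMap.star_eq_adjoint, star_mul, star_sub, star_one,
          hP.isSelfAdjoint.star_eq,
          (isStarProjection_starProjection (U := L)).isSelfAdjoint.star_eq]
      rwa [e] at this
    have e : P - L.starProjection = Lᗮ.starProjection * P - L.starProjection * (1 - P) := by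
      rw [hLo, sub_mul, one_mul, mul_sub, mul_one]
      abel
    rw [e]
    exact h1.sub hp h6
  · rintro ⟨hP, h⟩
    refine ⟨hP, ?_⟩
    have := completeSpace_range hP
    have hPr := starProjection_range hP
    set M : Submodule ℂ H := P.range with hM
    have h' : IsSchatten p (L.starProjection - M.starProjection) := by
      rw [hPr]
      simpa using h.neg hp0
    refine ⟨⟨relProj L M, ?_, ?_⟩, ?_⟩
    · rw [← relProj_self]
      change IsSchatten p (relProj L M ∘L relProj M L - relProj M M)
      rw [relProj_comp_sub]
      exact h'.comp hp0 _ _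
    · rw [← relProj_self]
      change IsSchatten p (relProj M L ∘L relProj L M - relProj L L)
      rw [relProj_comp_sub, hPr]
      exact h.comp hp0 _ _
    · have e : Lᗮ.starProjection ∘L M.subtypeL = (P - L.starProjection) ∘L M.subtypeL := by
        rw [hLo]
        ext x
        have : P x = x := by
          rw [← hPr]
          exact Submodule.starProjection_eq_self_iff.mpr x.2
        simp [this]
      rw [e]
      exact h.comp_clm hp0 _

/-- The index of the restricted projection is the index of the pair of subspaces. -/
theorem hasIndex_restrictedProj (hp : 1 ≤ p) {P : H →L[ℂ] H} (hP : IsStarProjection P)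
    (h : IsSchatten p (P - L.starProjection)) :
    HasIndex (restrictedProj L P : P.range →ₗ[ℂ] L) ∧
      fredholmIndex (restrictedProj L P) = pairIndex P.range L := by
  have := completeSpace_range hP
  have hc : IsCompactOperator (P.range.starProjection - L.starProjection : H →L[ℂ] H) := by
    rw [starProjection_range hP]
    exact isCompactOperator_of_isSchatten (one_pos.trans_le hp) h
  exact ⟨relProj_hasIndex hc, linearIndex_relProj hc⟩

end Characterizations

/-! ### The norm of the restricted algebra -/

section RestrictedNorm

universe u

variable {H : Type u} [NormedAddCommGroup H] [InnerProductSpace ℂ H] [CompleteSpace H] {p : ℝ}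
  {K : Submodule ℂ H} [CompleteSpace K]

theorem MemA.sub (hp : 1 ≤ p) {A B : H →L[ℂ] H} (hA : MemA p K A) (hB : MemA p K B) :
    MemA p K (A - B) := by
  have e : (A - B) * K.starProjection - K.starProjection * (A - B) =
      (A * K.starProjection - K.starProjection * A) -
        (B * K.starProjection - K.starProjection * B) := by
    simp only [mul_sub, sub_mul]
    abel
  unfold MemA
  rw [e]
  exact IsSchatten.sub hp hA hB

/-- Up to sign, the off-diagonal entries are the corners of the commutator with the projection onto
`K`. -/
theorem MemA.isSchatten_entry (hp : 0 < p) {A : H →L[ℂ] H} (hA : MemA p K A) :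
    IsSchatten p (entry K Kᗮ A) ∧ IsSchatten p (entry Kᗮ K A) := by
  constructor
  · have e : entry K Kᗮ A = -(K.orthogonalProjectionOnto ∘L
        (A * K.starProjection - K.starProjection * A) ∘L Kᗮ.subtypeL) := by
      ext x
      have h1 : K.starProjection (x : H) = 0 :=
        (Submodule.starProjection_apply_eq_zero_iff K).mpr x.2
      have h2 : K.starProjection (K.starProjection (A x)) = K.starProjection (A x) :=
        Submodule.starProjection_eq_self_iff.mpr (Submodule.starProjection_apply_mem _ _)
      simp [entry, h1, h2]
    rw [e]
    exact (IsSchatten.comp hp _ hA _).neg hp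
  · have e : entry Kᗮ K A = Kᗮ.orthogonalProjectionOnto ∘L
        (A * K.starProjection - K.starProjection * A) ∘L K.subtypeL := by
      ext x
      have h1 : K.starProjection (x : H) = x := Submodule.starProjection_eq_self_iff.mpr x.2
      have h2 : Kᗮ.starProjection (K.starProjection (A x)) = 0 :=
        (Submodule.starProjection_apply_eq_zero_iff Kᗮ).mpr (by
          rw [Submodule.orthogonal_orthogonal]
          exact Submodule.starProjection_apply_mem _ _)
      simp [entry, h1, h2]
    rw [e]
    exact IsSchatten.comp hp _ hA _

/-- The operator is the sum of its four matrix entries, and the Schatten norm dominates the operator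
norm off the diagonal. -/
theorem norm_le_normInfP (hp : 0 < p) {A : H →L[ℂ] H} (hA : MemA p K A) :
    ‖A‖ ≤ normInfP p K A := by
  obtain ⟨h12, h21⟩ := hA.isSchatten_entry hp
  have hle : ∀ (M N : Submodule ℂ H) [CompleteSpace M] [CompleteSpace N],
      ‖M.subtypeL ∘L entry M N A ∘L N.orthogonalProjectionOnto‖ ≤ ‖entry M N A‖ := by
    intro M N _ _
    refine (ContinuousLinearMap.opNorm_comp_le _ _).trans ?_
    refine (mul_le_mul (Submodule.norm_subtypeL_le M) (ContinuousLinearMap.opNorm_comp_le _ _)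
      (norm_nonneg _) zero_le_one).trans ?_
    rw [one_mul]
    exact mul_le_of_le_one_right (norm_nonneg _) (Submodule.orthogonalProjectionOnto_norm_le N)
  have e : A = K.subtypeL ∘L entry K K A ∘L K.orthogonalProjectionOnto +
      Kᗮ.subtypeL ∘L entry Kᗮ Kᗮ A ∘L Kᗮ.orthogonalProjectionOnto +
      K.subtypeL ∘L entry K Kᗮ A ∘L Kᗮ.orthogonalProjectionOnto +
      Kᗮ.subtypeL ∘L entry Kᗮ K A ∘L K.orthogonalProjectionOnto := by
    have hs : ∀ y : H, K.starProjection y + Kᗮ.starProjection y = y := fun y =>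
      Submodule.starProjection_add_starProjection_orthogonal y
    ext x
    change A x = K.starProjection (A (K.starProjection x)) +
      Kᗮ.starProjection (A (Kᗮ.starProjection x)) + K.starProjection (A (Kᗮ.starProjection x)) +
      Kᗮ.starProjection (A (K.starProjection x))
    conv_lhs => rw [← hs x, map_add, ← hs (A (K.starProjection x)),
      ← hs (A (Kᗮ.starProjection x))]
    abel
  conv_lhs => rw [e]
  unfold normInfP
  refine (norm_add_le _ _).trans (add_le_add ((norm_add_le _ _).trans (add_le_add
    ((norm_add_le _ _).trans (add_le_add (hle K K) (hle Kᗮ Kᗮ))) ?_)) ?_)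
  · exact (hle K Kᗮ).trans (norm_le_schattenNorm hp h12)
  · exact (hle Kᗮ K).trans (norm_le_schattenNorm hp h21)

/-- Each of the four entries is a compression of `A`. Hence Schatten continuity of a path implies
continuity in `𝓐^p`. -/
theorem normInfP_le (hp : 0 < p) {A : H →L[ℂ] H} (hA : IsSchatten p A) :
    normInfP p K A ≤ 4 * schattenNorm p A := by
  have h1 : ∀ (M N : Submodule ℂ H) [CompleteSpace M] [CompleteSpace N],
      schattenNorm p (entry M N A) ≤ schattenNorm p A ∧ ‖entry M N A‖ ≤ schattenNorm p A := by
    intro M N _ _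
    have h2 : schattenNorm p (entry M N A) ≤ schattenNorm p A := by
      refine (schattenNorm_comp_le hp _ hA _).trans
        (mul_le_of_le_one_left (schattenNorm_nonneg A) ?_)
      exact mul_le_one₀ (Submodule.orthogonalProjectionOnto_norm_le M) (norm_nonneg _)
        (Submodule.norm_subtypeL_le N)
    exact ⟨h2, (norm_le_schattenNorm hp (hA.comp hp _ _)).trans h2⟩
  unfold normInfP
  have := (h1 K K).2
  have := (h1 Kᗮ Kᗮ).2
  have := (h1 K Kᗮ).1
  have := (h1 Kᗮ K).1
  linarith

theorem tendsto_normInfP {α : Type*} {l : Filter α} (hp : 0 < p) {A : α → (H →L[ℂ] H)}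
    (h : Filter.Tendsto (fun a => traceAbsPow p (A a)) l (nhds 0)) :
    Filter.Tendsto (fun a => 4 * schattenNorm p (A a)) l (nhds 0) := by
  have h1 := (ENNReal.tendsto_toReal ENNReal.zero_ne_top).comp h
  have h2 := (h1.rpow_const (p := 1 / p) (Or.inr (by positivity))).const_mul 4
  rw [ENNReal.toReal_zero, Real.zero_rpow (by positivity), mul_zero] at h2
  exact h2

/-- A path of operators that is continuous for the Schatten norm has connected image in the
restricted algebra. -/
theorem isPreconnected_range_path (hp : 0 < p) {γ : ℝ → (H →L[ℂ] H)}
    (hmem : ∀ t ∈ Set.Icc (0 : ℝ) 1, MemA p K (γ t))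
    (hdiff : ∀ t ∈ Set.Icc (0 : ℝ) 1, ∀ s ∈ Set.Icc (0 : ℝ) 1, IsSchatten p (γ t - γ s))
    (hlim : ∀ s ∈ Set.Icc (0 : ℝ) 1, Filter.Tendsto (fun t => traceAbsPow p (γ t - γ s))
      (nhdsWithin s (Set.Icc 0 1)) (nhds 0)) :
    IsPreconnected (α := AlgA p K) (Set.range fun t : Set.Icc (0 : ℝ) 1 => ⟨γ t, hmem t t.2⟩) := by
  have : PreconnectedSpace (Set.Icc (0 : ℝ) 1) := Subtype.preconnectedSpace isPreconnected_Icc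
  refine isPreconnected_range (β := AlgA p K)
    ⟨fun U hU => isOpen_iff_mem_nhds.mpr fun s hs => ?_⟩
  have hU' : ∀ A ∈ U, ∃ r > 0, ∀ B : AlgA p K, normInfP p K (B.1 - A.1) < r → B ∈ U := hU
  obtain ⟨r, hr, h⟩ := hU' _ hs
  have h1 := tendsto_normInfP hp (hlim s s.2)
  rw [nhdsWithin_eq_map_subtype_coe s.2, Filter.tendsto_map'_iff] at h1
  filter_upwards [h1.eventually (gt_mem_nhds hr)] with t ht
  exact h _ ((normInfP_le hp (hdiff t t.2 s s.2)).trans_lt ht)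

end RestrictedNorm

/-! ### Connected components -/

section Components

universe u

variable {H : Type u} [NormedAddCommGroup H] [InnerProductSpace ℂ H] [CompleteSpace H] {p : ℝ}
  {K L : Submodule ℂ H} [CompleteSpace K] [CompleteSpace L]

theorem mem_GrIndex_iff (hp : 1 ≤ p) {P : H →L[ℂ] H} {k : ℤ} :
    P ∈ GrIndex L p k ↔ (IsStarProjection P ∧ IsSchatten p (P - L.starProjection)) ∧
      pairIndex P.range L = k := by
  rw [GrIndex, Set.mem_ofPred_eq, Gr_eq hp]
  refine and_congr_right fun h => ?_
  rw [(hasIndex_restrictedProj hp h.1 h.2).2]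

theorem GrIndex_nonempty (hp : 1 ≤ p) (hL : ¬ FiniteDimensional ℂ L)
    (hL' : ¬ FiniteDimensional ℂ Lᗮ) (k : ℤ) : (GrIndex L p k).Nonempty := by
  obtain ⟨W, hW, hWk⟩ := exists_linearIsometryEquiv_pairIndex_eq hp L hL hL' k
  refine ⟨(L.map (W.toLinearEquiv : H →ₗ[ℂ] H)).starProjection, (mem_GrIndex_iff hp).mpr
    ⟨⟨isStarProjection_starProjection, hW⟩, ?_⟩⟩
  rwa [Submodule.range_starProjection]

theorem pairIndex_range_add (hp : 1 ≤ p) {P Q : H →L[ℂ] H} {k : ℤ} (hP : P ∈ GrIndex L p k)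
    (hQ : IsStarProjection Q ∧ IsSchatten p (Q - L.starProjection)) :
    Q ∈ GrIndex L p (pairIndex Q.range P.range + k) := by
  have hp0 : 0 < p := one_pos.trans_le hp
  obtain ⟨⟨hP1, hP2⟩, hPk⟩ := (mem_GrIndex_iff hp).mp hP
  have := completeSpace_range hP1
  have := completeSpace_range hQ.1
  refine (mem_GrIndex_iff hp).mpr ⟨hQ, ?_⟩
  have h1 := hQ.2.sub hp hP2
  rw [sub_sub_sub_cancel_right] at h1
  rw [← hPk]
  refine pairIndex_add ?_ ?_
  · rw [starProjection_range hQ.1, starProjection_range hP1]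
    exact isCompactOperator_of_isSchatten hp0 h1
  · rw [starProjection_range hP1]
    exact isCompactOperator_of_isSchatten hp0 hP2

/-- By additivity, `l - k` is the index of the pair of ranges of `Q` and `P`, which vanishes at
distance less than one. -/
theorem eq_of_norm_sub_lt_one (hp : 1 ≤ p) {P Q : H →L[ℂ] H} {k l : ℤ} (hP : P ∈ GrIndex L p k)
    (hQ : Q ∈ GrIndex L p l) (h : ‖Q - P‖ < 1) : l = k := by
  obtain ⟨⟨hP1, hP2⟩, hPk⟩ := (mem_GrIndex_iff hp).mp hP
  obtain ⟨hQ1, hQl⟩ := (mem_GrIndex_iff hp).mp hQ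
  have h1 := ((mem_GrIndex_iff hp).mp (pairIndex_range_add hp hP hQ1)).2
  have := completeSpace_range hP1
  have := completeSpace_range hQ1.1
  have h2 : pairIndex Q.range P.range = 0 := by
    refine pairIndex_eq_zero_of_norm_sub_lt_one ?_
    rwa [starProjection_range hQ1.1, starProjection_range hP1]
  rw [h2, zero_add, hQl] at h1
  exact h1

/-- These sets serve to separate the indices. Since `‖·‖_{∞,p}` dominates the operator norm, the
triangle inequality of the latter suffices. -/
theorem isOpen_setOf_norm_sub_lt (hp : 1 ≤ p) (S : Set (H →L[ℂ] H)) (r : ℝ) :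
    IsOpen {A : AlgA p K | ∃ P ∈ S, ‖A.1 - P‖ < r} := by
  rintro A ⟨P, hP, hA⟩
  refine ⟨r - ‖A.1 - P‖, sub_pos.mpr hA, fun B hB => ⟨P, hP, ?_⟩⟩
  have h1 := norm_le_normInfP (one_pos.trans_le hp) (MemA.sub hp B.2 A.2)
  have h2 := norm_sub_le_norm_sub_add_norm_sub B.1 A.1 P
  linarith

variable (p K L) in
/-- The connected components are the sets of projections of constant index. -/
theorem connectedComponentIn_eq (hp : 1 ≤ p) (hKL : ∀ A : H →L[ℂ] H, MemA p K A ↔ MemA p L A)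
    {A : AlgA p K} {k : ℤ} (hA : A.1 ∈ GrIndex L p k) :
    connectedComponentIn (inAlgA p K
      {P | IsStarProjection P ∧ IsSchatten p (P - L.starProjection)}) A =
      inAlgA p K (GrIndex L p k) := by
  have hp0 : 0 < p := one_pos.trans_le hp
  set D := {P : H →L[ℂ] H | IsStarProjection P ∧ IsSchatten p (P - L.starProjection)} with hD
  obtain ⟨hA1, hAk⟩ := (mem_GrIndex_iff hp).mp hA
  have hAD : A ∈ inAlgA p K D := hA1
  apply Set.Subset.antisymm
  · have hmem : ∀ B ∈ inAlgA p K D, ∃ l, B.1 ∈ GrIndex L p l := fun B hB =>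
      ⟨_, (mem_GrIndex_iff hp).mpr ⟨hB, rfl⟩⟩
    -- Operator norm neighbourhoods of radius `1 / 2` of the projections of index `k`, and of those
    -- of other indices, are disjoint: a common point would put two projections of different index
    -- at distance less than one.
    have hsub : connectedComponentIn (inAlgA p K D) A ⊆
        {B : AlgA p K | ∃ P ∈ GrIndex L p k, ‖B.1 - P‖ < 1 / 2} := by
      refine IsPreconnected.subset_left_of_subset_union
        (v := {B : AlgA p K | ∃ P ∈ ⋃ l ∈ {l | l ≠ k}, GrIndex L p l, ‖B.1 - P‖ < 1 / 2})
        (isOpen_setOf_norm_sub_lt hp _ _) (isOpen_setOf_norm_sub_lt hp _ _) ?_ ?_ ?_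
        isPreconnected_connectedComponentIn
      · refine Set.disjoint_left.mpr ?_
        rintro B ⟨P, hP, hBP⟩ ⟨Q, hQ, hBQ⟩
        obtain ⟨l, hl, hQl⟩ := Set.mem_iUnion₂.mp hQ
        refine hl (eq_of_norm_sub_lt_one hp hP hQl ?_)
        have h2 := norm_sub_le_norm_sub_add_norm_sub Q B.1 P
        rw [norm_sub_rev Q B.1] at h2
        linarith
      · intro B hB
        have hBD := connectedComponentIn_subset _ _ hB
        obtain ⟨l, hl⟩ := hmem B hBD
        by_cases hlk : l = k
        · exact Or.inl ⟨B.1, hlk ▸ hl, by simp⟩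
        · exact Or.inr ⟨B.1, Set.mem_biUnion (show l ∈ {l | l ≠ k} from hlk) hl, by simp⟩
      · exact ⟨A, mem_connectedComponentIn hAD, A.1, hA, by simp⟩
    intro B hB
    obtain ⟨P, hP, hBP⟩ := hsub hB
    obtain ⟨l, hl⟩ := hmem B (connectedComponentIn_subset _ _ hB)
    have := eq_of_norm_sub_lt_one hp hP hl (hBP.trans (by norm_num))
    exact this ▸ hl
  · intro B hB
    obtain ⟨hB1, hBk⟩ := (mem_GrIndex_iff hp).mp hB
    have := completeSpace_range hA1.1
    have := completeSpace_range hB1.1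
    have hAB : IsSchatten p (A.1.range.starProjection - B.1.range.starProjection) := by
      rw [starProjection_range hA1.1, starProjection_range hB1.1, ← sub_sub_sub_cancel_right]
      exact hA1.2.sub hp hB1.2
    have hind : pairIndex A.1.range B.1.range = 0 := by
      have := ((mem_GrIndex_iff hp).mp (pairIndex_range_add hp hB hA1)).2
      omega
    -- Equal indices relative to `L` make the mutual index zero, so a path inside `D` joins the two
    -- projections.
    obtain ⟨γ, h0, h1, hγ, hlim⟩ := exists_path hp hAB hind
    rw [starProjection_range hA1.1] at h0 hγ
    rw [starProjection_range hB1.1] at h1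
    have hγD : ∀ t ∈ Set.Icc (0 : ℝ) 1, γ t ∈ D := fun t ht => by
      refine ⟨(hγ t ht).1, ?_⟩
      have := (hγ t ht).2.add hp hA1.2
      rwa [sub_add_sub_cancel] at this
    have hmem : ∀ t ∈ Set.Icc (0 : ℝ) 1, MemA p K (γ t) := fun t ht =>
      (hKL _).mpr (memA_of_isSchatten_sub hp (hγD t ht).2)
    have hpre := isPreconnected_range_path hp0 hmem (fun t ht s hs => by
      have := (hγ t ht).2.sub hp (hγ s hs).2
      rwa [sub_sub_sub_cancel_right] at this) hlim
    refine hpre.subset_connectedComponentIn ⟨⟨0, by simp⟩, Subtype.ext h0⟩ ?_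
      ⟨⟨1, by simp⟩, Subtype.ext h1⟩
    rintro _ ⟨t, rfl⟩
    exact hγD t t.2

/-- The index labels the connected components bijectively. -/
theorem bijOn_components (hp : 1 ≤ p) (hKL : ∀ A : H →L[ℂ] H, MemA p K A ↔ MemA p L A)
    (hL : ¬ FiniteDimensional ℂ L) (hL' : ¬ FiniteDimensional ℂ Lᗮ) :
    Set.BijOn (fun k : ℤ => inAlgA p K (GrIndex L p k)) Set.univ
      (components (inAlgA p K
        {P | IsStarProjection P ∧ IsSchatten p (P - L.starProjection)})) := by
  have hne : ∀ k, ∃ A : AlgA p K, A.1 ∈ GrIndex L p k := fun k => by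
    obtain ⟨P, hP⟩ := GrIndex_nonempty hp hL hL' k
    exact ⟨⟨P, (hKL P).mpr (memA_of_isSchatten_sub hp ((mem_GrIndex_iff hp).mp hP).1.2)⟩, hP⟩
  refine ⟨fun k _ => ?_, fun k _ l _ hkl => ?_, ?_⟩
  · obtain ⟨A, hA⟩ := hne k
    exact ⟨A, ((mem_GrIndex_iff hp).mp hA).1, (connectedComponentIn_eq p K L hp hKL hA).symm⟩
  · obtain ⟨A, hA⟩ := hne k
    have hA' : A ∈ inAlgA p K (GrIndex L p l) := by
      have h : A ∈ inAlgA p K (GrIndex L p k) := hA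
      rwa [show inAlgA p K (GrIndex L p k) = inAlgA p K (GrIndex L p l) from hkl] at h
    exact eq_of_norm_sub_lt_one hp hA' hA (by simp)
  · rintro _ ⟨A, hA, rfl⟩
    exact ⟨_, trivial, (connectedComponentIn_eq p K L hp hKL
      ((mem_GrIndex_iff hp).mpr ⟨hA, rfl⟩)).symm⟩

/-- The descriptions of the restricted Grassmannian of `L`, and its connected components. -/
theorem restrictedGrassmannian_characterization (hp : 1 ≤ p) (hKL : ∀ A : H →L[ℂ] H, MemA p K A ↔ MemA p L A)
    (hL : ¬ FiniteDimensional ℂ L) (hL' : ¬ FiniteDimensional ℂ Lᗮ) {D : Set (H →L[ℂ] H)}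
    (hD : D = {P | P ∈ projections p K ∧ calkin P = calkin L.starProjection}) :
    D = orbit p K L.starProjection ∧
      D = {P | IsStarProjection P ∧ IsSchatten p (P - L.starProjection)} ∧
      D = Gr L p ∧
      (∀ P ∈ D, FiniteDimensional ℂ (restrictedProj L P).ker ∧
        FiniteDimensional ℂ (L ⧸ (restrictedProj L P).range)) ∧
      Set.BijOn (fun k : ℤ => inAlgA p K (GrIndex L p k)) Set.univ
        (components (inAlgA p K D)) := by
  have hD' : D = {P | IsStarProjection P ∧ IsSchatten p (P - L.starProjection)} := by
    rw [hD, ← D3_eq hp]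
    simp only [D3, projections, hKL]
  have ho : orbit p K L.starProjection = orbit p L L.starProjection := by
    simp only [orbit, unitaries, hKL]
  subst hD'
  refine ⟨?_, rfl, (Gr_eq hp).symm, fun P hP => ?_, bijOn_components hp hKL hL hL'⟩
  · rw [ho]
    exact (subset_orbit hp hL hL').antisymm (orbit_subset hp)
  · have h := (hasIndex_restrictedProj hp hP.1 hP.2).1
    exact ⟨h.finite_ker, h.finite_coker⟩

end Components

end RestrictedGrassmannian

open RestrictedGrassmannian in
theorem mainTheorem5 {H : Type*} [NormedAddCommGroup H] [InnerProductSpace ℂ H] [CompleteSpace H]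
    (K : Submodule ℂ H) [CompleteSpace K]
    (hK : ¬ FiniteDimensional ℂ K) (hK' : ¬ FiniteDimensional ℂ Kᗮ)
    (p : ℝ) (hp : 1 ≤ p) :
    -- `𝔻₃` is the orbit of `E₊` and the restricted Grassmannian of `E₊`
    (D3 p K = orbit p K K.starProjection ∧
      D3 p K = {P | IsStarProjection P ∧ IsSchatten p (P - K.starProjection)} ∧
      D3 p K = Gr K p ∧
      -- the index is well defined on `𝔻₃`, and labels its connected components bijectively
      (∀ P ∈ D3 p K, FiniteDimensional ℂ (restrictedProj K P).ker ∧
        FiniteDimensional ℂ (K ⧸ (restrictedProj K P).range)) ∧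
      Set.BijOn (fun k : ℤ => inAlgA p K (GrIndex K p k)) Set.univ
        (components (inAlgA p K (D3 p K)))) ∧
    -- `𝔻₄` is the orbit of `E₋` and the restricted Grassmannian of `E₋`
    (D4 p K = orbit p K Kᗮ.starProjection ∧
      D4 p K = {P | IsStarProjection P ∧ IsSchatten p (P - Kᗮ.starProjection)} ∧
      D4 p K = Gr Kᗮ p ∧
      (∀ P ∈ D4 p K, FiniteDimensional ℂ (restrictedProj Kᗮ P).ker ∧
        FiniteDimensional ℂ (Kᗮ ⧸ (restrictedProj Kᗮ P).range)) ∧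
      Set.BijOn (fun k : ℤ => inAlgA p K (GrIndex Kᗮ p k)) Set.univ
        (components (inAlgA p K (D4 p K)))) := by
  -- The second half takes `L = Kᗮ` but keeps the algebra and the topology of `K`; `Kᗮᗮ = K`
  -- supplies the infinite codimension.
  refine ⟨restrictedGrassmannian_characterization hp (fun _ => Iff.rfl) hK hK' rfl,
    restrictedGrassmannian_characterization hp (fun _ => (memA_orthogonal (one_pos.trans_le hp)).symm) hK' ?_ rfl⟩
  rwa [Submodule.orthogonal_orthogonal]
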